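/- **Setting.** Let $m,n,r,q,s,l,l'\ge 0$ be integers, $x=(x_1,\dots,x_m)$ the independent variables, $u=(u_1,\dots,u_n)$ the dependent variables, $h=(h_1,\dots,h_m)$ the step sizes. For $N\ge 0$ let $J^N$ be the space of $(x,u,u^{(k_1)},\dots,u^{(k_1\cdots k_N)})$, where $u^{(k_1\cdots k_p)}\in\mathbb R^n$ stands for $\partial^p u/\partial x_{k_1}\cdots\partial x_{k_p}$ and is symmetric in $k_1,\dots,k_p$. *The group.* Let $G'_r$ be a smooth $r$-parameter local Lie group of transformations $$x^*=\phi(x,u,a),\qquad u^*=\varphi(x,u,a),\qquad h^*=\psi(x,u,h,a)$$ of an open set $M$ of the space of $(x,u,h)$, with parameter $a$ in a neighbourhood of $0$ in $\mathbb R^r$, the identity being $a=0$. The prolonged transformation $\widetilde G^{(l')}_r$ with parameter $a$ acts on points $(j,h)$ of $J^{l'}\times\mathbb R^m$: if $j$ is the $l'$-jet at $x$ of a smooth function $f$ for which $y\mapsto\phi(y,f(y),a)$ is a local diffeomorphism at $x$, and $g$ is the function whose graph near $x^*=\phi(x,f(x),a)$ is the transform of the graph of $f$ near $x$, then $(j,h)$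 is mapped to ($l'$-jet of $g$ at $x^*$, $\psi(x,f(x),h,a)$). *The operators.* For $\alpha=1,\dots,r$ put $\xi^\alpha=\partial\phi/\partial a_\alpha|_{a=0}$, $\eta^\alpha=\partial\varphi/\partial a_\alpha|_{a=0}$, $\zeta^\alpha=\partial\psi/\partial a_\alpha|_{a=0}$, and define recursively, with $D_k$ the total derivative with respect to $x_k$, $$\sigma_j^{\alpha,(k_1)}=D_{k_1}\eta_j^\alpha-\sum_{i=1}^m u_j^{(i)}D_{k_1}\xi_i^\alpha,\qquad \sigma_j^{\alpha,(k_1\cdots k_o)}=D_{k_o}\sigma_j^{\alpha,(k_1\cdots k_{o-1})}-\sum_{i=1}^m u_j^{(i\,k_1\cdots k_{o-1})}D_{k_o}\xi_i^\alpha .$$ Put $$\widetilde{\mathbf L}^{(N)}_\alpha=\sum_i\xi_i^\alpha\frac{\partial}{\partial x_i}+\sum_j\eta_j^\alpha\frac{\partial}{\partial u_j}+\sum_i\zeta_i^\alpha\frac{\partial}{\partial h_i}+\sum_j\sum_{p=1}^{N}\sum_{(k_1\cdots k_p)}\sigma_j^{\alpha,(k_1\cdots k_p)}\frac{\partial}{\partial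 u_j^{(k_1\cdots k_p)}},$$ the inner sum being over unordered multi-indices; the $\zeta$-term is absent when the operator is applied to functions that do not depend on $h$. *The differential approximation.* Let $\Omega\subset J^{l'}\times\mathbb R^m$ be open, with $(x,u,h)\in M$ at all its points (for example the whole space, or $h_i>0$). Let $$\mathcal P^\lambda=\mathcal F^\lambda+\sum_{\beta=1}^s\sum_{i=1}^m h_i^{l_\beta}\,\mathcal R^\lambda_{\beta,i},\qquad \lambda=1,\dots,q,$$ where the $l_\beta\ge 0$ are integers, $\mathcal F^\lambda$ is a smooth function on the image of $\Omega$ in $J^l$, the $\mathcal R^\lambda_{\beta,i}$ are smooth functions on the images of $\Omega$ in $J^{l'_{\beta,\lambda,i}}$, and $l\le l'$, $l'_{\beta,\lambda,i}\le l'$. (The $s$-th order differential approximation of a finite difference scheme has this form.) Assume that the system $\mathcal P=0$ has maximal rank: at each point of $\Omega$ where $\mathcal P^1=\dots=\mathcal P^q=0$, the differentials of $\mathcal P^1,\dots,\mathcal P^q$ with respect to all the variables $(x,u,u^{(k_1)},\dots,u^{(k_1\cdots k_{l'})},h)$ are linearly independent. The system $\mathcal P=0$ is called *invariant* under $\widetilde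 G^{(l')}_r$ if, for each $z\in\Omega$ with $\mathcal P^\lambda(z)=0$ for all $\lambda$, and for each $a$ in the connected component of $0$ in the set of parameters for which the prolonged transformation is defined at $z$ and maps it into $\Omega$, the transform of $z$ is again a common zero of $\mathcal P^1,\dots,\mathcal P^q$. **Theorem.** The differential approximation $\mathcal P=0$ is invariant under $\widetilde G^{(l')}_r$ if and only if $$\widetilde{\mathbf L}^{(l')}_\alpha\mathcal P^\lambda=0\quad\text{at all points of }\Omega\text{ where }\mathcal P^1=\dots=\mathcal P^q=0,\qquad \alpha=1,\dots,r,\ \lambda=1,\dots,q,$$ and also if and only if $$\widetilde{\mathbf L}^{(l)}_\alpha\mathcal F^\lambda+\widetilde{\mathbf L}^{(l')}_\alpha\Big(\sum_{\beta=1}^s\sum_{i=1}^m h_i^{l_\beta}\mathcal R^\lambda_{\beta,i}\Big)=0\quad\text{at all points of }\Omega\text{ where }\mathcal P^1=\dots=\mathcal P^q=0,\qquad \alpha=1,\dots,r,\ \lambda=1,\dots,q.$$ -/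

import Mathlib

open Set Filter Topology
open scoped ContDiff

noncomputable section

namespace StepLie

/-! ### Jet spaces -/

/-- Unordered multi-indices `(k₁ … k_p)` with `0 ≤ p ≤ N` and `k₁, …, k_p ∈ {1, …, m}`. -/
abbrev MIdx (m N : ℕ) : Type := {K : Multiset (Fin m) // K.card ≤ N}

instance instFiniteMIdx (m N : ℕ) : Finite (MIdx m N) := by
  have h : Function.Surjective
      (fun x : (Σ p : Fin (N + 1), Sym (Fin m) p) =>
        (⟨x.2.1, by have h1 := x.2.2; have h2 := x.1.2; omega⟩ : MIdx m N)) := by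
    rintro ⟨K, hK⟩
    exact ⟨⟨⟨K.card, by omega⟩, ⟨K, rfl⟩⟩, rfl⟩
  exact Finite.of_surjective _ h

instance instFintypeMIdx (m N : ℕ) : Fintype (MIdx m N) := Fintype.ofFinite _

/-- The space of `(x, u, u^{(k₁)}, …, u^{(k₁ … k_N)})`: a point `x`, and one value in `ℝⁿ` for each
multi-index of order at most `N`, the empty multi-index carrying `u` itself. -/
abbrev Jet (m n N : ℕ) : Type := (Fin m → ℝ) × (MIdx m N → Fin n → ℝ)

/-- The space of `(x, u, u^{(k₁)}, …, u^{(k₁ … k_N)}, h)`. -/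
abbrev ExtJet (m n N : ℕ) : Type := Jet m n N × (Fin m → ℝ)

/-- The space of `(x, u, h)`. -/
abbrev Base (m n : ℕ) : Type := (Fin m → ℝ) × (Fin n → ℝ) × (Fin m → ℝ)

/-- The coordinate `u^{(K)}` of a jet, with value `0` for `K` of order larger than `N`. -/
def Jet.coord {m n N : ℕ} (z : Jet m n N) (K : Multiset (Fin m)) : Fin n → ℝ :=
  if h : K.card ≤ N then z.2 ⟨K, h⟩ else 0

/-- The dependent variables `u` of a jet. -/
def Jet.val {m n N : ℕ} (z : Jet m n N) : Fin n → ℝ := z.2 ⟨0, Nat.zero_le N⟩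

/-- Forgetting the derivatives of order larger than `l` (used for `l ≤ N`). -/
def Jet.trunc {m n N : ℕ} (l : ℕ) (z : Jet m n N) : Jet m n l := (z.1, fun K => z.coord K.1)

/-- The point `(x, u, h)` under a point of the extended space. -/
def ExtJet.base {m n N : ℕ} (p : ExtJet m n N) : Base m n := (p.1.1, p.1.val, p.2)

/-- `∂_{k₁} ⋯ ∂_{k_p} f` for the list `[k₁, …, k_p]`. -/
def iterPartial {m n : ℕ} (f : (Fin m → ℝ) → (Fin n → ℝ)) :
    List (Fin m) → (Fin m → ℝ) → (Fin n → ℝ)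
  | [] => f
  | k :: L => fun x => fderiv ℝ (iterPartial f L) x (Pi.single k 1)

/-- The `N`-jet of `f` at `x`. -/
def jetAt {m n : ℕ} (N : ℕ) (f : (Fin m → ℝ) → (Fin n → ℝ)) (x : Fin m → ℝ) : Jet m n N :=
  (x, fun K => iterPartial f (K.1.sort (· ≤ ·)) x)

/-- The total derivative
`D_k = ∂/∂x_k + ∑_j ∑_K u_j^{(K k)} ∂/∂u_j^{(K)}`, the sum being over all `K` of order less than `N`;
it is applied only to functions on `Jet m n N` that depend on derivatives of order less than `N`. -/
def totalDeriv {m n N : ℕ} (k : Fin m) (F : Jet m n N → ℝ) (z : Jet m n N) : ℝ :=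
  fderiv ℝ F z (Pi.single k 1, fun K => z.coord (k ::ₘ K.1))

/-! ### Local Lie groups of transformations of `(x, u, h)` -/

/-- An `r`-parameter local Lie group: an open neighbourhood `V` of the identity `0` in `ℝ^r` with
a smooth multiplication `V × V → ℝ^r` and a smooth inversion `V → V`. -/
structure LocalLieGroup (r : ℕ) where
  V : Set (Fin r → ℝ)
  mul : (Fin r → ℝ) → (Fin r → ℝ) → (Fin r → ℝ)
  inv : (Fin r → ℝ) → (Fin r → ℝ)
  isOpen_V : IsOpen V
  zero_mem : 0 ∈ V
  contDiffOn_mul : ContDiffOn ℝ ∞ (fun p : (Fin r → ℝ) × (Fin r → ℝ) => mul p.1 p.2) (V ×ˢ V)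
  contDiffOn_inv : ContDiffOn ℝ ∞ inv V
  inv_mem : ∀ a ∈ V, inv a ∈ V
  zero_mul : ∀ a ∈ V, mul 0 a = a
  mul_zero : ∀ a ∈ V, mul a 0 = a
  inv_mul : ∀ a ∈ V, mul (inv a) a = 0
  mul_inv : ∀ a ∈ V, mul a (inv a) = 0
  assoc : ∀ a ∈ V, ∀ b ∈ V, ∀ c ∈ V, mul a b ∈ V → mul b c ∈ V →
    mul (mul a b) c = mul a (mul b c)

/-- The formulas `x* = φ(x, u, a)`, `u* = ϕ(x, u, a)`, `h* = ψ(x, u, h, a)`. -/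
structure StepAction (m n r : ℕ) where
  phi : (Fin m → ℝ) → (Fin n → ℝ) → (Fin r → ℝ) → (Fin m → ℝ)
  vphi : (Fin m → ℝ) → (Fin n → ℝ) → (Fin r → ℝ) → (Fin n → ℝ)
  psi : (Fin m → ℝ) → (Fin n → ℝ) → (Fin m → ℝ) → (Fin r → ℝ) → (Fin m → ℝ)

/-- The transformation of `(x, u, h)` with parameter `a`. -/
def StepAction.act {m n r : ℕ} (T : StepAction m n r) (e : Base m n) (a : Fin r → ℝ) : Base m n :=
  (T.phi e.1 e.2.1 a, T.vphi e.1 e.2.1 a, T.psi e.1 e.2.1 e.2.2 a)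

/-- An `r`-parameter local Lie group of transformations
`x* = φ(x, u, a)`, `u* = ϕ(x, u, a)`, `h* = ψ(x, u, h, a)` of an open set `M` of the space of
`(x, u, h)`; `dom` is the set of the pairs `(e, a)` for which the transform of `e` is defined. -/
structure StepGroup (m n r : ℕ) extends LocalLieGroup r, StepAction m n r where
  M : Set (Base m n)
  dom : Set (Base m n × (Fin r → ℝ))
  isOpen_M : IsOpen M
  isOpen_dom : IsOpen dom
  mem_of_dom : ∀ e a, (e, a) ∈ dom → e ∈ M ∧ a ∈ V
  zero_dom : ∀ e ∈ M, (e, 0) ∈ dom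
  act_mem : ∀ e a, (e, a) ∈ dom → toStepAction.act e a ∈ M
  contDiffOn_act : ContDiffOn ℝ ∞ (fun p : Base m n × (Fin r → ℝ) => toStepAction.act p.1 p.2) dom
  act_zero : ∀ e ∈ M, toStepAction.act e 0 = e
  act_act : ∀ e a b, (e, a) ∈ dom → (toStepAction.act e a, b) ∈ dom → (e, mul b a) ∈ dom →
    toStepAction.act (toStepAction.act e a) b = toStepAction.act e (mul b a)
  inv_dom : ∀ e a, (e, a) ∈ dom → (toStepAction.act e a, inv a) ∈ dom
  act_inv : ∀ e a, (e, a) ∈ dom → toStepAction.act (toStepAction.act e a) (inv a) = e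

namespace StepGroup

variable {m n r : ℕ}

/-! ### The prolonged group -/

/-- `G.ProlongsTo N a p p'`: the `N`-th prolongation of the transformation with parameter `a` is
defined at `p = (j, h)` and maps it to `p' = (j', h')`. That is, `j` is the `N`-jet at `x` of a
smooth `f`, the map `y ↦ φ(y, f(y), a)` is a local diffeomorphism at `x`, so that the transform of
the graph of `f` is near `x' = φ(x, f(x), a)` the graph of a smooth `g`, and `j'` is the
`N`-jet of `g` at `x'`. -/
def ProlongsTo (G : StepGroup m n r) (N : ℕ) (a : Fin r → ℝ) (p p' : ExtJet m n N) : Prop :=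
  (p.base, a) ∈ G.dom ∧ p'.2 = G.psi p.1.1 p.1.val p.2 a ∧
    ∃ f g : (Fin m → ℝ) → (Fin n → ℝ),
      ContDiffAt ℝ ∞ f p.1.1 ∧ jetAt N f p.1.1 = p.1 ∧
      (fderiv ℝ (fun y => G.phi y (f y) a) p.1.1).IsInvertible ∧
      ContDiffAt ℝ ∞ g (G.phi p.1.1 (f p.1.1) a) ∧
      (∀ᶠ y in 𝓝 p.1.1, g (G.phi y (f y) a) = G.vphi y (f y) a) ∧
      jetAt N g (G.phi p.1.1 (f p.1.1) a) = p'.1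

/-- The parameters `a` for which the prolonged transformation is defined at `p` and maps it into
the region `Ω`. -/
def prolongDomain (G : StepGroup m n r) {N : ℕ} (Ω : Set (ExtJet m n N)) (p : ExtJet m n N) :
    Set (Fin r → ℝ) :=
  {a | ∃ p' ∈ Ω, G.ProlongsTo N a p p'}

/-- The system `P = 0` in `Ω` is invariant under the prolonged local group: a zero of `P` is mapped
to zeros of `P` by the prolonged transformations with all those parameters that are connected to
the identity `0` through parameters for which the transform of the point is defined. -/
def IsInvariant (G : StepGroup m n r) {N q : ℕ} (Ω : Set (ExtJet m n N))
    (P : Fin q → ExtJet m n N → ℝ) : Prop :=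
  ∀ p ∈ Ω, (∀ lam, P lam p = 0) → ∀ a ∈ connectedComponentIn (G.prolongDomain Ω p) 0,
    ∀ p', G.ProlongsTo N a p p' → ∀ lam, P lam p' = 0

/-! ### The prolonged infinitesimal operators -/

/-- `ξ^α = ∂φ/∂a_α` at `a = 0`. -/
def xi (G : StepGroup m n r) (α : Fin r) (x : Fin m → ℝ) (u : Fin n → ℝ) : Fin m → ℝ :=
  fderiv ℝ (fun a => G.phi x u a) 0 (Pi.single α 1)

/-- `η^α = ∂ϕ/∂a_α` at `a = 0`. -/
def eta (G : StepGroup m n r) (α : Fin r) (x : Fin m → ℝ) (u : Fin n → ℝ) : Fin n → ℝ :=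
  fderiv ℝ (fun a => G.vphi x u a) 0 (Pi.single α 1)

/-- `ζ^α = ∂ψ/∂a_α` at `a = 0`. -/
def zeta (G : StepGroup m n r) (α : Fin r) (x : Fin m → ℝ) (u : Fin n → ℝ) (h : Fin m → ℝ) :
    Fin m → ℝ :=
  fderiv ℝ (fun a => G.psi x u h a) 0 (Pi.single α 1)

/-- The coefficients `σ_j^{α,(k₁ … k_o)}`, as functions on the jets of order `N ≥ o`, by
`σ_j^{()} = η_j` and
`σ_j^{(k₁ … k_o)} = D_{k_o} σ_j^{(k₁ … k_{o-1})} - ∑ᵢ u_j^{(i k₁ … k_{o-1})} D_{k_o} ξ_i`.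
The list is `[k_o, …, k₁]`. -/
def sigma (G : StepGroup m n r) (α : Fin r) (N : ℕ) (j : Fin n) :
    List (Fin m) → Jet m n N → ℝ
  | [] => fun z => G.eta α z.1 z.val j
  | k :: L => fun z =>
      totalDeriv k (sigma G α N j L) z -
        ∑ i, z.coord (i ::ₘ (L : Multiset (Fin m))) j *
          totalDeriv k (fun w : Jet m n N => G.xi α w.1 w.val i) z

/-- The coefficients `(ξ, η, σ^{(k₁)}, …, σ^{(k₁ … k_N)})` of the `N`-th prolongation; there is one
coefficient for each unordered multi-index. -/
def prolongField (G : StepGroup m n r) (α : Fin r) (N : ℕ) (z : Jet m n N) : Jet m n N :=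
  (G.xi α z.1 z.val, fun K j => G.sigma α N j (K.1.sort (· ≤ ·)) z)

/-- The `N`-th prolongation of `ξ_i ∂/∂x_i + η_j ∂/∂u_j`, applied to a function of
`(x, u, u^{(k₁)}, …, u^{(k₁ … k_N)})`. -/
def prolongOp (G : StepGroup m n r) (α : Fin r) (N : ℕ) (F : Jet m n N → ℝ) (z : Jet m n N) : ℝ :=
  fderiv ℝ F z (G.prolongField α N z)

/-- The `N`-th prolongation of `ξ_i ∂/∂x_i + η_j ∂/∂u_j + ζ_i ∂/∂h_i`, applied to a function of
`(x, u, u^{(k₁)}, …, u^{(k₁ … k_N)}, h)`. -/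
def prolongOpExt (G : StepGroup m n r) (α : Fin r) (N : ℕ) (P : ExtJet m n N → ℝ)
    (p : ExtJet m n N) : ℝ :=
  fderiv ℝ P p (G.prolongField α N p.1, G.zeta α p.1.1 p.1.val p.2)

end StepGroup

/-! ### Differential approximations -/

/-- The data of an `s`-th order differential approximation with `q` equations: functions `F^λ` of
the jets of order `l`, exponents `l_β`, and functions `R_{β,i}^λ` of the jets of order
`l'_{β,λ,i}`, all these orders being at most `l'`. -/
structure DiffApprox (m n q s l l' : ℕ) where
  F : Fin q → Jet m n l → ℝ
  expo : Fin s → ℕ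
  ordR : Fin s → Fin q → Fin m → ℕ
  R : (β : Fin s) → (lam : Fin q) → (i : Fin m) → Jet m n (ordR β lam i) → ℝ
  l_le : l ≤ l'
  ordR_le : ∀ β lam i, ordR β lam i ≤ l'

namespace DiffApprox

variable {m n q s l l' : ℕ}

/-- The correction `∑_β ∑_i h_i^{l_β} R_{β,i}^λ`. -/
def corr (A : DiffApprox m n q s l l') (lam : Fin q) (p : ExtJet m n l') : ℝ :=
  ∑ β, ∑ i, p.2 i ^ A.expo β * A.R β lam i (p.1.trunc (A.ordR β lam i))

/-- `P^λ = F^λ + ∑_β ∑_i h_i^{l_β} R_{β,i}^λ`. -/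
def P (A : DiffApprox m n q s l l') (lam : Fin q) (p : ExtJet m n l') : ℝ :=
  A.F lam (p.1.trunc l) + A.corr lam p

end DiffApprox

end StepLie

end

/-! Fix a point p over M and realise its jet by a polynomial f (`exists_jetAt_eq`). Transforming the
graph of f by the parameters near one at which the transform exists gives points Z(a) depending
smoothly on a (`exists_transform`, `transformPt`). They are the values of the prolonged
transformation at p, because the N-jet of a transformed graph depends only on the N-jet of the graph
(`ProlongsTo.unique`).

The derivative of Z at a = 0 is the prolonged operator (`fderiv_transformPt`): the recursion for σ
is the chain rule for the derivatives of the transformed function, differentiated once in a and read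
at a = 0 (`fderiv_pullPartial_param`). Necessity follows: invariance makes P ∘ Z vanish near 0, and
its derivative at 0 is L_α P at p.

For sufficiency, the group law turns the formula at 0 into a differential equation at every
parameter: dZ(a)v is a combination of the fields L_α at Z(a), with locally bounded coefficients
(`fderiv_transformPt_param`). Knowing L_α P = 0 on the zero set alone says nothing off it, but
maximal rank upgrades it to |L_α P| ≤ C|P| near each zero (`exists_norm_le_of_vanishing`). Grönwall
along segments of parameters then shows that a zero persists for nearby parameters
(`eventually_zero_of_zero`), while nonzero values persist by continuity. The component of 0 is thus
split into two relatively open sets, and connectedness leaves only the one containing 0.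

The second criterion differs from the first by linearity and by the fact that prolongation
coefficients do not depend on the order of the jet space (`prolongField_trunc`). -/

noncomputable section

namespace StepLie

/-! ### Iterated partial derivatives -/

section IterPartial

variable {m n : ℕ}

theorem contDiffAt_iterPartial {f : (Fin m → ℝ) → (Fin n → ℝ)} {x : Fin m → ℝ}
    (hf : ContDiffAt ℝ ∞ f x) (L : List (Fin m)) : ContDiffAt ℝ ∞ (iterPartial f L) x := by
  induction L with
  | nil => exact hf
  | cons k L ih => exact (ih.fderiv_right (m := ∞) (by simp)).clm_apply contDiffAt_const

/-- Only finite orders spread to a neighbourhood: smoothness of order `∞` at a point gives, for each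
k, a neighbourhood that may shrink as k grows. -/
theorem _root_.ContDiffAt.eventually_nat {E F : Type*} [NormedAddCommGroup E] [NormedSpace ℝ E]
    [NormedAddCommGroup F] [NormedSpace ℝ F] {f : E → F} {x : E}
    (hf : ContDiffAt ℝ ∞ f x) (k : ℕ) : ∀ᶠ y in 𝓝 x, ContDiffAt ℝ k f y :=
  (hf.of_le (by exact_mod_cast le_top)).eventually (by simp)

theorem _root_.ContDiffAt.eventually_differentiableAt {E F : Type*} [NormedAddCommGroup E]
    [NormedSpace ℝ E] [NormedAddCommGroup F] [NormedSpace ℝ F] {f : E → F} {x : E}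
    (hf : ContDiffAt ℝ ∞ f x) : ∀ᶠ y in 𝓝 x, DifferentiableAt ℝ f y :=
  (hf.eventually_nat 1).mono fun _ h => h.differentiableAt (by simp)

theorem iterPartial_congr {f g : (Fin m → ℝ) → (Fin n → ℝ)} {x : Fin m → ℝ}
    (h : f =ᶠ[𝓝 x] g) (L : List (Fin m)) : iterPartial f L =ᶠ[𝓝 x] iterPartial g L := by
  induction L with
  | nil => exact h
  | cons k L ih =>
    filter_upwards [ih.fderiv (𝕜 := ℝ)] with y hy
    simp only [iterPartial, hy]

/-- Mixed second partial derivatives commute. -/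
theorem fderiv_fderiv_comm {E F : Type*} [NormedAddCommGroup E] [NormedSpace ℝ E]
    [NormedAddCommGroup F] [NormedSpace ℝ F] {f : E → F} {x : E} (hf : ContDiffAt ℝ 2 f x)
    (v w : E) :
    fderiv ℝ (fun y => fderiv ℝ f y v) x w = fderiv ℝ (fun y => fderiv ℝ f y w) x v := by
  have hd : DifferentiableAt ℝ (fderiv ℝ f) x :=
    (hf.fderiv_right (m := 1) (by norm_num)).differentiableAt (by simp)
  have h2 : IsSymmSndFDerivAt ℝ f x :=
    hf.isSymmSndFDerivAt (by simp [minSmoothness_of_isRCLikeNormedField])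
  rw [fderiv_clm_apply hd (differentiableAt_const v),
    fderiv_clm_apply hd (differentiableAt_const w)]
  simpa using h2 w v

/-- Adjacent swaps generate all permutations. Equality of germs, not just of values, lets the
induction differentiate once more. -/
theorem iterPartial_perm {f : (Fin m → ℝ) → (Fin n → ℝ)} {x : Fin m → ℝ}
    (hf : ContDiffAt ℝ ∞ f x) {L L' : List (Fin m)} (h : L.Perm L') :
    iterPartial f L =ᶠ[𝓝 x] iterPartial f L' := by
  induction h with
  | nil => exact .rfl
  | cons k _ ih =>
    filter_upwards [ih.fderiv (𝕜 := ℝ)] with y hy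
    simp only [iterPartial, hy]
  | swap a b L =>
    filter_upwards [(contDiffAt_iterPartial hf L).eventually_nat 2] with y hy
    exact fderiv_fderiv_comm hy _ _
  | trans _ _ h1 h2 => exact h1.trans h2

theorem iterPartial_ofFn {f : (Fin m → ℝ) → (Fin n → ℝ)} {x : Fin m → ℝ}
    (hf : ContDiffAt ℝ ∞ f x) {N : ℕ} (k : Fin N → Fin m) :
    ∀ᶠ y in 𝓝 x, iterPartial f (List.ofFn k) y =
      iteratedFDeriv ℝ N f y (fun i => Pi.single (k i) 1) := by
  induction N with
  | zero => simp [iterPartial]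
  | succ N ih =>
    have h1 : ContDiffAt ℝ ∞ (iteratedFDeriv ℝ N f) x :=
      hf.iteratedFDeriv_right (by exact_mod_cast le_top)
    have h2 := EventuallyEq.fderiv (𝕜 := ℝ) (ih fun i => k i.succ)
    filter_upwards [h2, h1.eventually_differentiableAt] with y hy hy'
    rw [List.ofFn_succ, hy'.iteratedFDeriv_succ_apply_left']
    simp only [iterPartial, hy]
    rfl

/-- A multilinear map is determined by its values on tuples of basis vectors, which here are the
iterated partial derivatives. -/
theorem iteratedFDeriv_eq_of_iterPartial_eq {f g : (Fin m → ℝ) → (Fin n → ℝ)} {x : Fin m → ℝ}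
    (hf : ContDiffAt ℝ ∞ f x) (hg : ContDiffAt ℝ ∞ g x) {N : ℕ}
    (h : ∀ L : List (Fin m), L.length = N → iterPartial f L x = iterPartial g L x) :
    iteratedFDeriv ℝ N f x = iteratedFDeriv ℝ N g x := by
  apply ContinuousMultilinearMap.toMultilinearMap_injective
  refine Module.Basis.ext_multilinear (fun _ => Pi.basisFun ℝ (Fin m)) fun k => ?_
  have h1 := (iterPartial_ofFn hf k).self_of_nhds
  have h2 := (iterPartial_ofFn hg k).self_of_nhds
  simp only [Pi.basisFun_apply, ContinuousMultilinearMap.coe_coe]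
  rw [← h1, ← h2]
  exact h _ (by simp)

theorem iterPartial_eq_of_iteratedFDeriv_eq {f g : (Fin m → ℝ) → (Fin n → ℝ)} {x : Fin m → ℝ}
    (hf : ContDiffAt ℝ ∞ f x) (hg : ContDiffAt ℝ ∞ g x) (L : List (Fin m))
    (h : iteratedFDeriv ℝ L.length f x = iteratedFDeriv ℝ L.length g x) :
    iterPartial f L x = iterPartial g L x := by
  have h1 := (iterPartial_ofFn hf L.get).self_of_nhds
  have h2 := (iterPartial_ofFn hg L.get).self_of_nhds
  rw [List.ofFn_get] at h1 h2
  rw [h1, h2, h]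

theorem jetAt_val {N : ℕ} (f : (Fin m → ℝ) → (Fin n → ℝ)) (x : Fin m → ℝ) :
    (jetAt N f x).val = f x := by
  simp [Jet.val, jetAt, iterPartial]

/-- Passes from jet coordinates to coordinate-free derivatives, to which Faà di Bruno's formula
applies. Symmetry of the derivatives makes the sorted lists sufficient. -/
theorem jetAt_eq_iff {f g : (Fin m → ℝ) → (Fin n → ℝ)} {x : Fin m → ℝ}
    (hf : ContDiffAt ℝ ∞ f x) (hg : ContDiffAt ℝ ∞ g x) {N : ℕ} :
    jetAt N f x = jetAt N g x ↔
      ∀ i ≤ N, iteratedFDeriv ℝ i f x = iteratedFDeriv ℝ i g x := by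
  constructor
  · intro h i hi
    refine iteratedFDeriv_eq_of_iterPartial_eq hf hg fun L hL => ?_
    have h1 := congrFun (Prod.ext_iff.1 h).2 ⟨(L : Multiset (Fin m)), by simpa [hL] using hi⟩
    have h2 : L.Perm ((L : Multiset (Fin m)).sort (· ≤ ·)) := by
      rw [← Multiset.coe_eq_coe, Multiset.sort_eq]
    rw [(iterPartial_perm hf h2).self_of_nhds, (iterPartial_perm hg h2).self_of_nhds]
    exact h1
  · intro h
    refine Prod.ext rfl (funext fun K => ?_)
    exact iterPartial_eq_of_iteratedFDeriv_eq hf hg _ (h _ (by simpa using K.2))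

end IterPartial

/-! ### Taylor polynomials -/

section Taylor

variable {m n : ℕ}

/-- The monomial `∏ᵢ (yᵢ - xᵢ)^{cᵢ} / cᵢ!`, `cᵢ` being the multiplicity of `i` in `K`. -/
def divMono (x : Fin m → ℝ) (K : Multiset (Fin m)) (y : Fin m → ℝ) : ℝ :=
  ∏ i, (y i - x i) ^ K.count i / (K.count i).factorial

theorem contDiff_divMono (x : Fin m → ℝ) (K : Multiset (Fin m)) :
    ContDiff ℝ ∞ (divMono x K) := by
  unfold divMono
  refine contDiff_prod fun i _ => ?_
  fun_prop

/-- Only the factor in the k-th coordinate varies, and t^c/c! has derivative t^(c-1)/(c-1)!, so no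
constants appear. -/
theorem fderiv_divMono (x : Fin m → ℝ) (K : Multiset (Fin m)) (y : Fin m → ℝ) (k : Fin m) :
    fderiv ℝ (divMono x K) y (Pi.single k 1) =
      if k ∈ K then divMono x (K.erase k) y else 0 := by
  have h0 : DifferentiableAt ℝ (divMono x K) y :=
    (contDiff_divMono x K).contDiffAt.differentiableAt (by simp)
  rw [← h0.lineDeriv_eq_fderiv, lineDeriv]
  have h1 : (fun t : ℝ => divMono x K (y + t • Pi.single k 1)) = fun t =>
      ((y k + t - x k) ^ K.count k / (K.count k).factorial) *
        ∏ i ∈ Finset.univ.erase k, (y i - x i) ^ K.count i / (K.count i).factorial := by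
    funext t
    rw [divMono, ← Finset.mul_prod_erase _ _ (Finset.mem_univ k)]
    congr 1
    · simp
    · refine Finset.prod_congr rfl fun i hi => ?_
      simp [Pi.single_eq_of_ne (Finset.ne_of_mem_erase hi)]
  have h2 : HasDerivAt (fun t : ℝ => (y k + t - x k) ^ K.count k / (K.count k).factorial)
      ((K.count k * (y k + 0 - x k) ^ (K.count k - 1) * 1) / (K.count k).factorial) 0 :=
    (((((hasDerivAt_id (0 : ℝ)).const_add (y k)).sub_const (x k)).pow _).div_const _)
  rw [h1, (h2.mul_const _).deriv]
  split_ifs with hk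
  · rw [divMono, ← Finset.mul_prod_erase _ _ (Finset.mem_univ k)]
    congr 1
    · obtain ⟨c, hc⟩ := Nat.exists_eq_succ_of_ne_zero (Multiset.count_ne_zero.2 hk)
      rw [Multiset.count_erase_self, hc]
      simp only [Nat.succ_eq_add_one, Nat.add_sub_cancel, add_zero, mul_one, Nat.factorial_succ,
        Nat.cast_mul]
      have : ((c + 1 : ℕ) : ℝ) ≠ 0 := by positivity
      field_simp
    · refine Finset.prod_congr rfl fun i hi => ?_
      rw [Multiset.count_erase_of_ne (Finset.ne_of_mem_erase hi)]
  · simp [Multiset.count_eq_zero.2 hk]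

theorem divMono_self (x : Fin m → ℝ) (K : Multiset (Fin m)) :
    divMono x K x = if K = 0 then 1 else 0 := by
  split_ifs with h
  · simp [h, divMono]
  · obtain ⟨i, hi⟩ := Multiset.exists_mem_of_ne_zero h
    refine Finset.prod_eq_zero (Finset.mem_univ i) ?_
    simp [Multiset.count_ne_zero.2 hi]

/-- The guard on the order of multisets is essential: subtraction of multisets truncates, whereas
too many derivatives give 0. -/
theorem iterPartial_sum_divMono {ι : Type*} (s : Finset ι) (x : Fin m → ℝ)
    (K : ι → Multiset (Fin m)) (c : ι → Fin n → ℝ) (L : List (Fin m)) :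
    iterPartial (fun y => ∑ i ∈ s, divMono x (K i) y • c i) L =
      fun y => ∑ i ∈ s, (if (L : Multiset (Fin m)) ≤ K i then
        divMono x (K i - (L : Multiset (Fin m))) y else 0) • c i := by
  induction L with
  | nil => simp [iterPartial]
  | cons k L ih =>
    funext y
    have hd : ∀ M : Multiset (Fin m), DifferentiableAt ℝ (divMono x M) y := fun M =>
      (contDiff_divMono x M).contDiffAt.differentiableAt (by simp)
    have hd' : ∀ i, DifferentiableAt ℝ (fun y => (if (L : Multiset (Fin m)) ≤ K i then
        divMono x (K i - (L : Multiset (Fin m))) y else 0)) y := by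
      intro i
      split_ifs
      · exact hd _
      · exact differentiableAt_const _
    simp only [iterPartial, ih]
    rw [fderiv_fun_sum fun i _ => (hd' i).smul_const _]
    rw [sum_apply]
    refine Finset.sum_congr rfl fun i _ => ?_
    rw [fderiv_smul_const (hd' i)]
    simp only [ContinuousLinearMap.smulRight_apply]
    congr 1
    by_cases h : (L : Multiset (Fin m)) ≤ K i
    · simp only [h, if_true, fderiv_divMono]
      have h1 : ((k :: L : List (Fin m)) : Multiset (Fin m)) = {k} + (L : Multiset (Fin m)) := rfl
      have h2 : (k ∈ K i - (L : Multiset (Fin m))) ↔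
          ((k :: L : List (Fin m)) : Multiset (Fin m)) ≤ K i := by
        rw [h1, ← Multiset.singleton_le, le_tsub_iff_right h]
      simp only [h2]
      congr 2
      rw [h1, add_comm, ← tsub_tsub, Multiset.sub_singleton]
    · have h1 : ¬ ((k :: L : List (Fin m)) : Multiset (Fin m)) ≤ K i := fun h2 =>
        h (le_trans (Multiset.le_cons_self (L : Multiset (Fin m)) k) h2)
      simp [h, h1]

/-- Every point of the jet space is the jet of a smooth function. -/
theorem exists_jetAt_eq {N : ℕ} (z : Jet m n N) :
    ∃ f : (Fin m → ℝ) → (Fin n → ℝ), ContDiff ℝ ∞ f ∧ jetAt N f z.1 = z := by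
  refine ⟨fun y => ∑ K : MIdx m N, divMono z.1 K.1 y • z.2 K, ?_, ?_⟩
  · exact ContDiff.sum fun K _ => (contDiff_divMono z.1 K.1).smul contDiff_const
  · refine Prod.ext rfl (funext fun K => ?_)
    simp only [jetAt]
    rw [iterPartial_sum_divMono]
    beta_reduce
    -- At the centre, the term of K' survives only if K ≤ K' and K' - K = 0, that is, K' = K.
    rw [Finset.sum_eq_single K]
    · simp [divMono_self]
    · intro K' _ hne
      rw [Multiset.sort_eq]
      split_ifs with h
      · rw [divMono_self, if_neg, zero_smul]
        intro h0
        exact hne (Subtype.ext (le_antisymm (tsub_eq_zero_iff_le.1 h0) h))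
      · rw [zero_smul]
    · simp

end Taylor

/-! ### Uniqueness of the prolonged transformation -/

section Uniqueness

variable {m n r : ℕ}

/-- Faà di Bruno: the i-th derivative of a composite involves only derivatives of both factors of
order at most i. -/
theorem iteratedFDeriv_comp_congr {E F H : Type*} [NormedAddCommGroup E] [NormedSpace ℝ E]
    [NormedAddCommGroup F] [NormedSpace ℝ F] [NormedAddCommGroup H] [NormedSpace ℝ H]
    {g g' : F → H} {f f' : E → F} {x : E} {N : ℕ}
    (hg : ContDiffAt ℝ ∞ g (f x)) (hg' : ContDiffAt ℝ ∞ g' (f x))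
    (hf : ContDiffAt ℝ ∞ f x) (hf' : ContDiffAt ℝ ∞ f' x)
    (hgg : ∀ i ≤ N, iteratedFDeriv ℝ i g (f x) = iteratedFDeriv ℝ i g' (f x))
    (hff : ∀ i ≤ N, iteratedFDeriv ℝ i f x = iteratedFDeriv ℝ i f' x) :
    ∀ i ≤ N, iteratedFDeriv ℝ i (g ∘ f) x = iteratedFDeriv ℝ i (g' ∘ f') x := by
  intro i hi
  have hx : f' x = f x := by
    have := congrArg (fun T => T (fun _ => 0)) (hff 0 (Nat.zero_le _))
    simpa using this.symm
  have hi' : (i : WithTop ℕ∞) ≤ ∞ := by exact_mod_cast le_top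
  rw [iteratedFDeriv_comp hg hf hi', iteratedFDeriv_comp (by rwa [hx]) hf' hi']
  simp only [FormalMultilinearSeries.taylorComp]
  refine Finset.sum_congr rfl fun c _ => ?_
  ext v
  simp only [FormalMultilinearSeries.compAlongOrderedFinpartition_apply, ftaylorSeries, hx]
  rw [hgg _ (c.length_le.trans hi)]
  congr 1
  funext j
  simp only [OrderedFinpartition.applyOrderedFinpartition]
  rw [hff _ ((c.partSize_le j).trans hi)]

namespace StepGroup

variable (G : StepGroup m n r)

/-! ### Smoothness of the group formulas, at points and along graphs -/

theorem contDiffAt_act {e : Base m n} {a : Fin r → ℝ} (h : (e, a) ∈ G.dom) :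
    ContDiffAt ℝ ∞ (fun p : Base m n × (Fin r → ℝ) => G.act p.1 p.2) (e, a) :=
  G.contDiffOn_act.contDiffAt (G.isOpen_dom.mem_nhds h)

theorem contDiffAt_phi {x : Fin m → ℝ} {u : Fin n → ℝ} {h : Fin m → ℝ} {a : Fin r → ℝ}
    (hd : ((x, u, h), a) ∈ G.dom) :
    ContDiffAt ℝ ∞ (fun p : (Fin m → ℝ) × (Fin n → ℝ) × (Fin r → ℝ) => G.phi p.1 p.2.1 p.2.2)
      (x, u, a) := by
  have h1 : ContDiffAt ℝ ∞ (fun p : (Fin m → ℝ) × (Fin n → ℝ) × (Fin r → ℝ) =>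
      (((p.1, p.2.1, h), p.2.2) : Base m n × (Fin r → ℝ))) (x, u, a) := by fun_prop
  exact contDiffAt_fst.comp (x, u, a) (ContDiffAt.comp (x, u, a) (G.contDiffAt_act hd) h1)

theorem contDiffAt_vphi {x : Fin m → ℝ} {u : Fin n → ℝ} {h : Fin m → ℝ} {a : Fin r → ℝ}
    (hd : ((x, u, h), a) ∈ G.dom) :
    ContDiffAt ℝ ∞ (fun p : (Fin m → ℝ) × (Fin n → ℝ) × (Fin r → ℝ) => G.vphi p.1 p.2.1 p.2.2)
      (x, u, a) := by
  have h1 : ContDiffAt ℝ ∞ (fun p : (Fin m → ℝ) × (Fin n → ℝ) × (Fin r → ℝ) =>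
      (((p.1, p.2.1, h), p.2.2) : Base m n × (Fin r → ℝ))) (x, u, a) := by fun_prop
  exact (contDiffAt_fst.comp _ contDiffAt_snd).comp (x, u, a)
    (ContDiffAt.comp (x, u, a) (G.contDiffAt_act hd) h1)

theorem contDiffAt_psi {x : Fin m → ℝ} {u : Fin n → ℝ} {h : Fin m → ℝ} {a : Fin r → ℝ}
    (hd : ((x, u, h), a) ∈ G.dom) :
    ContDiffAt ℝ ∞ (fun p : Base m n × (Fin r → ℝ) => G.psi p.1.1 p.1.2.1 p.1.2.2 p.2)
      ((x, u, h), a) :=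
  (contDiffAt_snd.comp _ contDiffAt_snd).comp ((x, u, h), a) (G.contDiffAt_act hd)

theorem contDiffAt_phi_graph {f : (Fin m → ℝ) → (Fin n → ℝ)} {x h : Fin m → ℝ} {a : Fin r → ℝ}
    (hf : ContDiffAt ℝ ∞ f x) (hd : ((x, f x, h), a) ∈ G.dom) :
    ContDiffAt ℝ ∞ (fun p : (Fin m → ℝ) × (Fin r → ℝ) => G.phi p.1 (f p.1) p.2) (x, a) := by
  have h1 : ContDiffAt ℝ ∞ (fun p : (Fin m → ℝ) × (Fin r → ℝ) => (p.1, f p.1, p.2)) (x, a) :=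
    contDiffAt_fst.prodMk ((ContDiffAt.comp (x, a) hf contDiffAt_fst).prodMk contDiffAt_snd)
  exact ContDiffAt.comp (x, a) (G.contDiffAt_phi hd) h1

theorem contDiffAt_vphi_graph {f : (Fin m → ℝ) → (Fin n → ℝ)} {x h : Fin m → ℝ} {a : Fin r → ℝ}
    (hf : ContDiffAt ℝ ∞ f x) (hd : ((x, f x, h), a) ∈ G.dom) :
    ContDiffAt ℝ ∞ (fun p : (Fin m → ℝ) × (Fin r → ℝ) => G.vphi p.1 (f p.1) p.2) (x, a) := by
  have h1 : ContDiffAt ℝ ∞ (fun p : (Fin m → ℝ) × (Fin r → ℝ) => (p.1, f p.1, p.2)) (x, a) :=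
    contDiffAt_fst.prodMk ((ContDiffAt.comp (x, a) hf contDiffAt_fst).prodMk contDiffAt_snd)
  exact ContDiffAt.comp (x, a) (G.contDiffAt_vphi hd) h1

variable {G}

/-- The prolonged transformation with parameter `a` has at most one value at a point. -/
theorem ProlongsTo.unique {N : ℕ} {a : Fin r → ℝ} {p p₁ p₂ : ExtJet m n N}
    (h₁ : G.ProlongsTo N a p p₁) (h₂ : G.ProlongsTo N a p p₂) : p₁ = p₂ := by
  obtain ⟨hd, hp₁, f₁, g₁, hf₁, hj₁, hi₁, hg₁, he₁, hk₁⟩ := h₁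
  obtain ⟨-, hp₂, f₂, g₂, hf₂, hj₂, -, hg₂, he₂, hk₂⟩ := h₂
  refine Prod.ext ?_ (hp₁.trans hp₂.symm)
  obtain ⟨⟨x, w⟩, h⟩ := p
  dsimp only at *
  have hf : ∀ i ≤ N, iteratedFDeriv ℝ i f₁ x = iteratedFDeriv ℝ i f₂ x :=
    (jetAt_eq_iff hf₁ hf₂).1 (hj₁.trans hj₂.symm)
  have hu : f₂ x = f₁ x := by rw [← jetAt_val (N := N) f₂, hj₂, ← hj₁, jetAt_val]
  have hd' : ((x, f₁ x, h), a) ∈ G.dom := by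
    rw [← jetAt_val (N := N) f₁, hj₁]; exact hd
  have hi : ∀ i ≤ N, iteratedFDeriv ℝ i (fun y => (y, f₁ y)) x =
      iteratedFDeriv ℝ i (fun y => (y, f₂ y)) x := by
    intro i hi
    have hi' : (i : WithTop ℕ∞) ≤ ∞ := by exact_mod_cast le_top
    rw [iteratedFDeriv_prodMk (f := fun y => y) contDiffAt_id hf₁ hi',
      iteratedFDeriv_prodMk (f := fun y => y) contDiffAt_id hf₂ hi', hf i hi]
  have hs : ContDiffAt ℝ ∞ (fun y : (Fin m → ℝ) × (Fin n → ℝ) => (y.1, y.2, a)) (x, f₁ x) := by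
    fun_prop
  have hphi : ContDiffAt ℝ ∞ (fun y : (Fin m → ℝ) × (Fin n → ℝ) => G.phi y.1 y.2 a) (x, f₁ x) :=
    ContDiffAt.comp (x, f₁ x)
      (g := fun p : (Fin m → ℝ) × (Fin n → ℝ) × (Fin r → ℝ) => G.phi p.1 p.2.1 p.2.2)
      (G.contDiffAt_phi hd') hs
  have hvphi : ContDiffAt ℝ ∞ (fun y : (Fin m → ℝ) × (Fin n → ℝ) => G.vphi y.1 y.2 a)
      (x, f₁ x) :=
    ContDiffAt.comp (x, f₁ x)
      (g := fun p : (Fin m → ℝ) × (Fin n → ℝ) × (Fin r → ℝ) => G.vphi p.1 p.2.1 p.2.2)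
      (G.contDiffAt_vphi hd') hs
  have hc₁ : ContDiffAt ℝ ∞ (fun y => (y, f₁ y)) x := contDiffAt_id.prodMk hf₁
  have hc₂ : ContDiffAt ℝ ∞ (fun y => (y, f₂ y)) x := contDiffAt_id.prodMk hf₂
  have hΦ := iteratedFDeriv_comp_congr (f := fun y => (y, f₁ y)) (f' := fun y => (y, f₂ y))
    hphi hphi hc₁ hc₂ (fun _ _ => rfl) hi
  have hV := iteratedFDeriv_comp_congr (f := fun y => (y, f₁ y)) (f' := fun y => (y, f₂ y))
    hvphi hvphi hc₁ hc₂ (fun _ _ => rfl) hi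
  have hΦ₁ : ContDiffAt ℝ ∞ (fun y => G.phi y (f₁ y) a) x :=
    ContDiffAt.comp (f := fun y => (y, f₁ y)) x hphi hc₁
  have hΦ₂ : ContDiffAt ℝ ∞ (fun y => G.phi y (f₂ y) a) x :=
    ContDiffAt.comp (f := fun y => (y, f₂ y))
      (g := fun y : (Fin m → ℝ) × (Fin n → ℝ) => G.phi y.1 y.2 a) x (by rw [hu]; exact hphi) hc₂
  rw [hu] at hk₂ hg₂
  -- With Φᵢ(y) = φ(y, fᵢ(y), a), compare N-jets: g₁ ∘ Φ₁ is ϕ along f₁, which agrees with ϕ along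
  -- f₂, which is g₂ ∘ Φ₂, which agrees with g₂ ∘ Φ₁.
  have hgg : ∀ i ≤ N, iteratedFDeriv ℝ i (g₁ ∘ fun y => G.phi y (f₁ y) a) x =
      iteratedFDeriv ℝ i (g₂ ∘ fun y => G.phi y (f₁ y) a) x := by
    intro i hi
    have e1 : (g₁ ∘ fun y => G.phi y (f₁ y) a) =ᶠ[𝓝 x] fun y => G.vphi y (f₁ y) a := he₁
    have e2 : (g₂ ∘ fun y => G.phi y (f₂ y) a) =ᶠ[𝓝 x] fun y => G.vphi y (f₂ y) a := he₂
    rw [(e1.iteratedFDeriv ℝ i).self_of_nhds]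
    refine (hV i hi).trans ?_
    refine ((e2.iteratedFDeriv ℝ i).self_of_nhds).symm.trans ?_
    exact (iteratedFDeriv_comp_congr (f := fun y => G.phi y (f₁ y) a)
      (f' := fun y => G.phi y (f₂ y) a) hg₂ hg₂ hΦ₁ hΦ₂ (fun _ _ => rfl) hΦ i hi).symm
  obtain ⟨Λ, hΛ⟩ := hi₁
  have hdΦ : HasFDerivAt (fun y => G.phi y (f₁ y) a) (Λ : (Fin m → ℝ) →L[ℝ] (Fin m → ℝ)) x := by
    rw [hΛ]; exact (hΦ₁.differentiableAt (by simp)).hasFDerivAt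
  have hinv := (hΦ₁.hasStrictFDerivAt' hdΦ (by simp)).eventually_right_inverse
  have hΨ := hΦ₁.to_localInverse hdΦ (by simp)
  have hΨx := hΦ₁.localInverse_apply_image hdΦ (by simp)
  have hgg₁ : ContDiffAt ℝ ∞ (g₁ ∘ fun y => G.phi y (f₁ y) a) x := hg₁.comp x hΦ₁
  have hgg₂ : ContDiffAt ℝ ∞ (g₂ ∘ fun y => G.phi y (f₁ y) a) x := hg₂.comp x hΦ₁
  -- Composing with the local inverse of Φ₁ recovers the jets of g₁ and g₂ themselves.
  have key := iteratedFDeriv_comp_congr (N := N) (by rw [hΨx]; exact hgg₁)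
    (by rw [hΨx]; exact hgg₂) hΨ hΨ (by rw [hΨx]; exact hgg) (fun _ _ => rfl)
  rw [← hk₁, ← hk₂, jetAt_eq_iff hg₁ hg₂]
  intro i hi
  have e : ∀ g : (Fin m → ℝ) → (Fin n → ℝ),
      (g ∘ fun y => G.phi y (f₁ y) a) ∘ hΦ₁.localInverse hdΦ (by simp)
        =ᶠ[𝓝 (G.phi x (f₁ x) a)] g := fun g => hinv.mono fun y hy => congrArg g hy
  rw [← ((e g₁).iteratedFDeriv ℝ i).self_of_nhds, ← ((e g₂).iteratedFDeriv ℝ i).self_of_nhds]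
  exact key i hi

end StepGroup

end Uniqueness

/-! ### Functions on the jet space and total derivatives -/

section TotalDeriv

variable {m n r N : ℕ}

theorem contDiff_coord (K : Multiset (Fin m)) :
    ContDiff ℝ ∞ (fun z : Jet m n N => z.coord K) := by
  unfold Jet.coord
  split_ifs
  · fun_prop
  · exact contDiff_const

theorem contDiff_val : ContDiff ℝ ∞ (fun z : Jet m n N => z.val) := by
  unfold Jet.val
  fun_prop

/-- The direction `∂/∂x_k + ∑ u_j^{(K k)} ∂/∂u_j^{(K)}` of the total derivative. -/
def totalDir (k : Fin m) (z : Jet m n N) : Jet m n N :=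
  (Pi.single k 1, fun K => z.coord (k ::ₘ K.1))

theorem contDiff_totalDir (k : Fin m) : ContDiff ℝ ∞ (totalDir (n := n) (N := N) k) :=
  contDiff_const.prodMk (contDiff_pi.2 fun K => contDiff_coord (k ::ₘ K.1))

theorem contDiffAt_totalDeriv {F : Jet m n N → ℝ} {z : Jet m n N} (hF : ContDiffAt ℝ ∞ F z)
    (k : Fin m) : ContDiffAt ℝ ∞ (totalDeriv k F) z :=
  (hF.fderiv_right (m := ∞) (by simp)).clm_apply (contDiff_totalDir k).contDiffAt

/-- The displacement `v` changes only derivatives of order larger than `k`. -/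
def IsHigh (k : ℕ) (v : Jet m n N) : Prop :=
  v.1 = 0 ∧ ∀ K : MIdx m N, K.1.card ≤ k → v.2 K = 0

/-- The function `F` depends only on derivatives of order at most `k`. -/
def HasOrder (k : ℕ) (F : Jet m n N → ℝ) : Prop :=
  ∀ z v, IsHigh k v → F (z + v) = F z

theorem IsHigh.mono {k l : ℕ} {v : Jet m n N} (h : IsHigh l v) (hkl : k ≤ l) : IsHigh k v :=
  ⟨h.1, fun K hK => h.2 K (hK.trans hkl)⟩

theorem HasOrder.mono {k l : ℕ} {F : Jet m n N → ℝ} (h : HasOrder k F) (hkl : k ≤ l) :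
    HasOrder l F := fun z v hv => h z v (hv.mono hkl)

/-- F is constant on the line through z in direction v. Where F is not differentiable, `fderiv` is 0
by convention. -/
theorem HasOrder.fderiv_eq_zero {k : ℕ} {F : Jet m n N → ℝ} (h : HasOrder k F) (z : Jet m n N)
    {v : Jet m n N} (hv : IsHigh k v) : fderiv ℝ F z v = 0 := by
  by_cases hF : DifferentiableAt ℝ F z
  · rw [← hF.lineDeriv_eq_fderiv, lineDeriv]
    have h1 : (fun t : ℝ => F (z + t • v)) = fun _ => F z := by
      funext t
      exact h z (t • v) ⟨by simp [hv.1], fun K hK => by simp [hv.2 K hK]⟩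
    rw [h1, deriv_const]
  · rw [fderiv_zero_of_not_differentiableAt hF]
    rfl

theorem HasOrder.fderiv_add {k : ℕ} {F : Jet m n N → ℝ} (h : HasOrder k F) (z : Jet m n N)
    {v : Jet m n N} (hv : IsHigh k v) : fderiv ℝ F (z + v) = fderiv ℝ F z := by
  rw [← fderiv_comp_add_right]
  congr 1
  funext w
  exact h w v hv

theorem IsHigh.coord {k : ℕ} {v : Jet m n N} (h : IsHigh k v) {K : Multiset (Fin m)}
    (hK : K.card ≤ k) : v.coord K = 0 := by
  unfold Jet.coord
  split_ifs with h1
  · exact h.2 ⟨K, h1⟩ hK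
  · rfl

theorem coord_add (z v : Jet m n N) (K : Multiset (Fin m)) :
    (z + v).coord K = z.coord K + v.coord K := by
  unfold Jet.coord
  split_ifs
  · rfl
  · simp

/-- The total direction at K reads the coordinate of one order more, so a displacement above order k
+ 1 changes it only above order k, where the differential of F vanishes. -/
theorem HasOrder.totalDeriv {k : ℕ} {F : Jet m n N → ℝ} (h : HasOrder k F) (i : Fin m) :
    HasOrder (k + 1) (totalDeriv i F) := by
  intro z v hv
  have h1 : totalDir i (z + v) = totalDir i z + (0, fun K => v.coord (i ::ₘ K.1)) := by
    refine Prod.ext (by simp [totalDir]) (funext fun K => ?_)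
    exact coord_add z v _
  have h2 : IsHigh k ((0, fun K => v.coord (i ::ₘ K.1)) : Jet m n N) :=
    ⟨rfl, fun K hK => hv.coord (by simpa using hK)⟩
  change fderiv ℝ F (z + v) (totalDir i (z + v)) = fderiv ℝ F z (totalDir i z)
  rw [h.fderiv_add z (hv.mono (Nat.le_succ k)), h1, map_add, h.fderiv_eq_zero z h2, add_zero]

theorem HasOrder.of_val (F : (Fin m → ℝ) → (Fin n → ℝ) → ℝ) :
    HasOrder (N := N) 0 (fun z : Jet m n N => F z.1 z.val) := by
  intro z v hv
  have h1 : (z + v).1 = z.1 := by simp [hv.1]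
  have h2 : (z + v).val = z.val := by
    simp only [Jet.val, Prod.snd_add, Pi.add_apply]
    rw [hv.2 _ (by simp), add_zero]
  simp only [h1, h2]

/-! ### Jets of functions -/

theorem coord_jetAt {f : (Fin m → ℝ) → (Fin n → ℝ)} {x : Fin m → ℝ}
    (hf : ContDiffAt ℝ ∞ f x) (L : List (Fin m)) (hL : L.length ≤ N) :
    ∀ᶠ y in 𝓝 x, (jetAt N f y).coord (L : Multiset (Fin m)) = iterPartial f L y := by
  have h2 : ((L : Multiset (Fin m)).sort (· ≤ ·)).Perm L := by
    rw [← Multiset.coe_eq_coe, Multiset.sort_eq]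
  filter_upwards [iterPartial_perm hf h2] with y hy
  unfold Jet.coord
  rw [dif_pos (by simpa using hL)]
  exact hy

/-- The total derivative of `F` at the jet of `f` is the partial derivative of `F` along the jets
of `f`. -/
theorem fderiv_comp_jetAt {f : (Fin m → ℝ) → (Fin n → ℝ)} {x : Fin m → ℝ}
    (hf : ContDiffAt ℝ ∞ f x) (i : Fin m) :
    ∀ᶠ y in 𝓝 x, ∀ (k : ℕ) (F : Jet m n N → ℝ), HasOrder k F → k < N →
      DifferentiableAt ℝ F (jetAt N f y) →
      fderiv ℝ (fun y => F (jetAt N f y)) y (Pi.single i 1) = totalDeriv i F (jetAt N f y) := by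
  have h1 : ∀ᶠ y in 𝓝 x, ∀ K : MIdx m N,
      DifferentiableAt ℝ (iterPartial f (K.1.sort (· ≤ ·))) y :=
    eventually_all.2 fun K => (contDiffAt_iterPartial hf _).eventually_differentiableAt
  have h2 : ∀ᶠ y in 𝓝 x, ∀ K : MIdx m N, K.1.card < N →
      (jetAt N f y).coord (i ::ₘ K.1) = iterPartial f (i :: K.1.sort (· ≤ ·)) y := by
    refine eventually_all.2 fun K => ?_
    by_cases hK : K.1.card < N
    · filter_upwards [coord_jetAt (N := N) hf (i :: K.1.sort (· ≤ ·))
        (by simp only [List.length_cons, Multiset.length_sort]; omega)] with y hy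
      rw [← Multiset.cons_coe, Multiset.sort_eq] at hy
      exact fun _ => hy
    · exact Eventually.of_forall fun _ h => absurd h hK
  filter_upwards [h1, h2] with y hy1 hy2 k F h hk hF
  have h3 : HasFDerivAt (jetAt N f) ((ContinuousLinearMap.id ℝ (Fin m → ℝ)).prod
      (ContinuousLinearMap.pi fun K : MIdx m N =>
        fderiv ℝ (iterPartial f (K.1.sort (· ≤ ·))) y)) y :=
    (hasFDerivAt_id y).prodMk (hasFDerivAt_pi.2 fun K => (hy1 K).hasFDerivAt)
  have h4 : HasFDerivAt (fun y => F (jetAt N f y)) _ y := hF.hasFDerivAt.comp y h3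
  rw [h4.fderiv, ContinuousLinearMap.comp_apply]
  change _ = fderiv ℝ F (jetAt N f y) (totalDir i (jetAt N f y))
  rw [← sub_eq_zero, ← map_sub]
  -- The velocity of the jet of f and the total direction may differ only at order N, where the
  -- latter is set to 0; the differential of F ignores that order since k < N.
  refine h.fderiv_eq_zero _ ⟨by simp [totalDir], fun K hK => ?_⟩
  simp [totalDir, hy2 K (by omega), iterPartial]

end TotalDeriv

/-! ### The coefficients of the prolonged operators -/

namespace StepGroup

variable {m n r N : ℕ} (G : StepGroup m n r)

theorem contDiffAt_xi (α : Fin r) {x h : Fin m → ℝ} {u : Fin n → ℝ} (hM : (x, u, h) ∈ G.M) :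
    ContDiffAt ℝ ∞ (fun p : (Fin m → ℝ) × (Fin n → ℝ) => G.xi α p.1 p.2) (x, u) := by
  have h1 : ContDiffAt ℝ ∞ (Function.uncurry fun (p : (Fin m → ℝ) × (Fin n → ℝ)) a =>
      G.phi p.1 p.2 a) ((x, u), 0) :=
    ContDiffAt.comp (g := fun p : (Fin m → ℝ) × (Fin n → ℝ) × (Fin r → ℝ) =>
        G.phi p.1 p.2.1 p.2.2) (f := fun p : ((Fin m → ℝ) × (Fin n → ℝ)) × (Fin r → ℝ) =>
        (p.1.1, p.1.2, p.2)) ((x, u), 0) (G.contDiffAt_phi (G.zero_dom _ hM)) (by fun_prop)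
  exact (ContDiffAt.fderiv (g := fun _ => 0) h1 contDiffAt_const (by simp)).clm_apply
    contDiffAt_const

theorem contDiffAt_eta (α : Fin r) {x h : Fin m → ℝ} {u : Fin n → ℝ} (hM : (x, u, h) ∈ G.M) :
    ContDiffAt ℝ ∞ (fun p : (Fin m → ℝ) × (Fin n → ℝ) => G.eta α p.1 p.2) (x, u) := by
  have h1 : ContDiffAt ℝ ∞ (Function.uncurry fun (p : (Fin m → ℝ) × (Fin n → ℝ)) a =>
      G.vphi p.1 p.2 a) ((x, u), 0) :=
    ContDiffAt.comp (g := fun p : (Fin m → ℝ) × (Fin n → ℝ) × (Fin r → ℝ) =>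
        G.vphi p.1 p.2.1 p.2.2) (f := fun p : ((Fin m → ℝ) × (Fin n → ℝ)) × (Fin r → ℝ) =>
        (p.1.1, p.1.2, p.2)) ((x, u), 0) (G.contDiffAt_vphi (G.zero_dom _ hM)) (by fun_prop)
  exact (ContDiffAt.fderiv (g := fun _ => 0) h1 contDiffAt_const (by simp)).clm_apply
    contDiffAt_const

theorem contDiffAt_zeta (α : Fin r) {e : Base m n} (hM : e ∈ G.M) :
    ContDiffAt ℝ ∞ (fun p : Base m n => G.zeta α p.1 p.2.1 p.2.2) e := by
  have h1 : ContDiffAt ℝ ∞ (Function.uncurry fun (p : Base m n) a =>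
      G.psi p.1 p.2.1 p.2.2 a) (e, 0) := G.contDiffAt_psi (G.zero_dom _ hM)
  exact (ContDiffAt.fderiv (g := fun _ => 0) h1 contDiffAt_const (by simp)).clm_apply
    contDiffAt_const

theorem contDiffAt_xi_jet (α : Fin r) {z : Jet m n N} {h : Fin m → ℝ}
    (hM : (z.1, z.val, h) ∈ G.M) :
    ContDiffAt ℝ ∞ (fun w : Jet m n N => G.xi α w.1 w.val) z :=
  ContDiffAt.comp (f := fun w : Jet m n N => (w.1, w.val))
    (g := fun p : (Fin m → ℝ) × (Fin n → ℝ) => G.xi α p.1 p.2) z (G.contDiffAt_xi α hM)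
    (contDiffAt_fst.prodMk contDiff_val.contDiffAt)

theorem hasOrder_sigma (α : Fin r) (j : Fin n) (L : List (Fin m)) :
    HasOrder L.length (G.sigma α N j L) := by
  induction L with
  | nil => exact HasOrder.of_val fun x u => G.eta α x u j
  | cons k L ih =>
    intro z v hv
    have h1 := ih.totalDeriv k z v hv
    have h2 : ∀ i, totalDeriv k (fun w : Jet m n N => G.xi α w.1 w.val i) (z + v) =
        totalDeriv k (fun w : Jet m n N => G.xi α w.1 w.val i) z := fun i =>
      (HasOrder.of_val fun x u => G.xi α x u i).totalDeriv k z v (hv.mono (by simp))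
    simp only [sigma, h1, h2, coord_add]
    congr 1
    refine Finset.sum_congr rfl fun i _ => ?_
    rw [hv.coord (K := i ::ₘ (L : Multiset (Fin m))) (by simp), add_zero]

theorem contDiffAt_sigma (α : Fin r) (j : Fin n) (L : List (Fin m)) {z : Jet m n N}
    {h : Fin m → ℝ} (hM : (z.1, z.val, h) ∈ G.M) : ContDiffAt ℝ ∞ (G.sigma α N j L) z := by
  induction L with
  | nil =>
    refine contDiffAt_pi.1 (ContDiffAt.comp (f := fun w : Jet m n N => (w.1, w.val))
      (g := fun p : (Fin m → ℝ) × (Fin n → ℝ) => G.eta α p.1 p.2) z (G.contDiffAt_eta α hM)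
      (contDiffAt_fst.prodMk contDiff_val.contDiffAt)) j
  | cons k L ih =>
    refine (contDiffAt_totalDeriv ih k).sub (ContDiffAt.sum fun i _ => ?_)
    refine (contDiffAt_pi.1 (contDiff_coord _).contDiffAt j).mul (contDiffAt_totalDeriv ?_ k)
    exact contDiffAt_pi.1 (G.contDiffAt_xi_jet α hM) i

theorem contDiffAt_prolongField (α : Fin r) {p : ExtJet m n N} (hM : p.base ∈ G.M) :
    ContDiffAt ℝ ∞ (fun p : ExtJet m n N =>
      ((G.prolongField α N p.1, G.zeta α p.1.1 p.1.val p.2) : ExtJet m n N)) p := by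
  have h1 : ContDiffAt ℝ ∞ (G.prolongField α N) p.1 :=
    (G.contDiffAt_xi_jet α hM).prodMk (contDiffAt_pi.2 fun _ => contDiffAt_pi.2 fun j =>
      G.contDiffAt_sigma α j _ hM)
  have h2 : ContDiffAt ℝ ∞ (fun p : ExtJet m n N => p.base) p := by
    unfold ExtJet.base Jet.val
    fun_prop
  exact (ContDiffAt.comp p h1 contDiffAt_fst).prodMk
    (ContDiffAt.comp (g := fun p : Base m n => G.zeta α p.1 p.2.1 p.2.2) p
      (G.contDiffAt_zeta α hM) h2)

end StepGroup

/-! ### Transforms of graphs, depending smoothly on the parameter -/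

/-- The map is block triangular with invertible diagonal blocks A and id; its inverse is (y, a) ↦
(A⁻¹(y - T(0, a)), a). -/
theorem exists_equiv_prod_snd {E R : Type*} [NormedAddCommGroup E] [NormedSpace ℝ E]
    [NormedAddCommGroup R] [NormedSpace ℝ R] (T : E × R →L[ℝ] E)
    (h : (T.comp (ContinuousLinearMap.inl ℝ E R)).IsInvertible) :
    ∃ e : (E × R) ≃L[ℝ] (E × R), (e : E × R →L[ℝ] E × R) =
      T.prod (ContinuousLinearMap.snd ℝ E R) := by
  obtain ⟨A, hA⟩ := h
  have hT : ∀ q : E × R, T q = A q.1 + T (0, q.2) := by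
    intro q
    have h1 : A q.1 = T (q.1, 0) := DFunLike.congr_fun hA q.1
    rw [h1, ← map_add]
    simp
  refine ⟨ContinuousLinearEquiv.equivOfInverse (T.prod (ContinuousLinearMap.snd ℝ E R))
    (((A.symm : E →L[ℝ] E).comp (ContinuousLinearMap.fst ℝ E R -
      T.comp ((ContinuousLinearMap.inr ℝ E R).comp (ContinuousLinearMap.snd ℝ E R)))).prod
      (ContinuousLinearMap.snd ℝ E R)) ?_ ?_, rfl⟩
  · intro q
    refine Prod.ext ?_ rfl
    simp [hT q]
  · intro q
    refine Prod.ext ?_ rfl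
    simp only [ContinuousLinearMap.prod_apply]
    rw [hT]
    simp

namespace StepGroup

variable {m n r N : ℕ} (G : StepGroup m n r)

theorem eventually_mem_dom {X : Type*} [TopologicalSpace X] {q : X → Base m n × (Fin r → ℝ)}
    {t : X} (hq : ContinuousAt q t) (h : q t ∈ G.dom) : ∀ᶠ s in 𝓝 t, q s ∈ G.dom :=
  hq.eventually (G.isOpen_dom.mem_nhds h)

theorem contDiffAt_fderiv_phi_graph {f : (Fin m → ℝ) → (Fin n → ℝ)} {x h : Fin m → ℝ}
    {a : Fin r → ℝ} (hf : ContDiffAt ℝ ∞ f x) (hd : ((x, f x, h), a) ∈ G.dom) :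
    ContDiffAt ℝ ∞ (fun a => fderiv ℝ (fun y => G.phi y (f y) a) x) a := by
  refine ContDiffAt.fderiv (f := fun a y => G.phi y (f y) a) (g := fun _ => x) ?_
    contDiffAt_const (m := ∞) (n := ∞) (by simp)
  exact ContDiffAt.comp (g := fun p : (Fin m → ℝ) × (Fin r → ℝ) => G.phi p.1 (f p.1) p.2)
    (f := Prod.swap) (a, x) (G.contDiffAt_phi_graph hf hd) (contDiffAt_snd.prodMk contDiffAt_fst)

/-- The invertible operators form an open set, and the derivative along the graph depends
continuously on a. -/
theorem eventually_isInvertible {f : (Fin m → ℝ) → (Fin n → ℝ)} {x h : Fin m → ℝ}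
    {a₀ : Fin r → ℝ} (hf : ContDiffAt ℝ ∞ f x) (hd : ((x, f x, h), a₀) ∈ G.dom)
    (hi : (fderiv ℝ (fun y => G.phi y (f y) a₀) x).IsInvertible) :
    ∀ᶠ a in 𝓝 a₀, (fderiv ℝ (fun y => G.phi y (f y) a) x).IsInvertible := by
  obtain ⟨e, he⟩ := hi
  have h1 := (G.contDiffAt_fderiv_phi_graph hf hd).continuousAt.eventually
    (p := fun T => T ∈ range ((↑) : ((Fin m → ℝ) ≃L[ℝ] (Fin m → ℝ)) → _))
    (by beta_reduce; rw [← he]; exact ContinuousLinearEquiv.nhds e)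
  exact h1

/-- The transforms of the graph of `f` near a point are the graphs of functions depending smoothly
on the parameter. -/
theorem exists_transform {f : (Fin m → ℝ) → (Fin n → ℝ)} {x h : Fin m → ℝ} {a₀ : Fin r → ℝ}
    (hf : ContDiffAt ℝ ∞ f x) (hd : ((x, f x, h), a₀) ∈ G.dom)
    (hi : (fderiv ℝ (fun y => G.phi y (f y) a₀) x).IsInvertible) :
    ∃ g : (Fin m → ℝ) × (Fin r → ℝ) → (Fin n → ℝ),
      (∀ᶠ a in 𝓝 a₀, ContDiffAt ℝ ∞ g (G.phi x (f x) a, a)) ∧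
      ∀ᶠ p in 𝓝 (x, a₀), g (G.phi p.1 (f p.1) p.2, p.2) = G.vphi p.1 (f p.1) p.2 := by
  have hdom : ∀ᶠ a in 𝓝 a₀, ((x, f x, h), a) ∈ G.dom :=
    G.eventually_mem_dom (q := fun a => ((x, f x, h), a)) (by fun_prop) hd
  have hdiff : ∀ a, ((x, f x, h), a) ∈ G.dom → ContDiffAt ℝ ∞
      (fun p : (Fin m → ℝ) × (Fin r → ℝ) => (G.phi p.1 (f p.1) p.2, p.2)) (x, a) :=
    fun a ha => (G.contDiffAt_phi_graph hf ha).prodMk contDiffAt_snd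
  have hderiv : ∀ a, ((x, f x, h), a) ∈ G.dom →
      (fderiv ℝ (fun y => G.phi y (f y) a) x).IsInvertible →
      ∃ e : ((Fin m → ℝ) × (Fin r → ℝ)) ≃L[ℝ] ((Fin m → ℝ) × (Fin r → ℝ)), HasFDerivAt
        (fun p : (Fin m → ℝ) × (Fin r → ℝ) => (G.phi p.1 (f p.1) p.2, p.2))
        (e : (Fin m → ℝ) × (Fin r → ℝ) →L[ℝ] (Fin m → ℝ) × (Fin r → ℝ)) (x, a) := by
    intro a ha hia
    have h1 := ((G.contDiffAt_phi_graph hf ha).differentiableAt (by simp)).hasFDerivAt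
    have h2 : HasFDerivAt (fun y => (y, a))
        (ContinuousLinearMap.inl ℝ (Fin m → ℝ) (Fin r → ℝ)) x := hasFDerivAt_prodMk_left x a
    have h3 := HasFDerivAt.comp (g := fun p : (Fin m → ℝ) × (Fin r → ℝ) =>
      G.phi p.1 (f p.1) p.2) (f := fun y => (y, a)) x h1 h2
    obtain ⟨e, he⟩ := exists_equiv_prod_snd _ (by rw [← h3.fderiv]; exact hia)
    exact ⟨e, by rw [he]; exact h1.prodMk hasFDerivAt_snd⟩
  obtain ⟨e, he⟩ := hderiv a₀ hd hi
  -- Inverting (y, a) ↦ (φ(y, f(y), a), a) jointly, instead of for each a separately, makes g smooth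
  -- in both variables.
  set H := (hdiff a₀ hd).toOpenPartialHomeomorph _ he (by simp) with hH
  have hsrc : ∀ᶠ p in 𝓝 (x, a₀), p ∈ H.source :=
    H.open_source.mem_nhds ((hdiff a₀ hd).mem_toOpenPartialHomeomorph_source he (by simp))
  have hHc : ∀ p, H p = (G.phi p.1 (f p.1) p.2, p.2) := fun p => rfl
  refine ⟨fun q => G.vphi (H.symm q).1 (f (H.symm q).1) (H.symm q).2, ?_, ?_⟩
  · have hs : ∀ᶠ a in 𝓝 a₀, (x, a) ∈ H.source :=
      (Continuous.prodMk_right x).continuousAt.eventually hsrc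
    -- Since f is known to be smooth to infinite order only at x, smoothness of the inverse is
    -- proved separately at the image of each (x, a).
    filter_upwards [hs, hdom, G.eventually_isInvertible hf hd hi] with a h1 h2 h3
    obtain ⟨e', he'⟩ := hderiv a h2 h3
    have h4 : H.symm (G.phi x (f x) a, a) = (x, a) := by
      have := H.left_inv h1
      rwa [hHc] at this
    have h5 : ContDiffAt ℝ ∞ H.symm (G.phi x (f x) a, a) := by
      refine H.contDiffAt_symm (f₀' := e') ?_ ?_ ?_
      · have := H.map_source h1
        rwa [hHc] at this
      · rw [h4]; exact he'
      · rw [h4]; exact hdiff a h2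
    exact ContDiffAt.comp (g := fun p : (Fin m → ℝ) × (Fin r → ℝ) => G.vphi p.1 (f p.1) p.2)
      (f := H.symm) _ (by rw [h4]; exact G.contDiffAt_vphi_graph hf h2) h5
  · filter_upwards [hsrc] with p hp
    have h4 : H.symm (G.phi p.1 (f p.1) p.2, p.2) = p := by
      have := H.left_inv hp
      rwa [hHc] at this
    simp only [h4]

/-- The transform with parameter `a` of the point `(jet of f at x, h)`, where `g (·, a)` is the
transform of `f`. -/
def transformPt (N : ℕ) (f : (Fin m → ℝ) → (Fin n → ℝ)) (x h : Fin m → ℝ)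
    (g : (Fin m → ℝ) × (Fin r → ℝ) → (Fin n → ℝ)) (a : Fin r → ℝ) : ExtJet m n N :=
  (jetAt N (fun y => g (y, a)) (G.phi x (f x) a), G.psi x (f x) h a)

theorem contDiffAt_iterPartial_param {g : (Fin m → ℝ) × (Fin r → ℝ) → (Fin n → ℝ)}
    {q : (Fin m → ℝ) × (Fin r → ℝ)} (hg : ContDiffAt ℝ ∞ g q) (L : List (Fin m)) :
    ContDiffAt ℝ ∞ (fun p : (Fin m → ℝ) × (Fin r → ℝ) =>
      iterPartial (fun y => g (y, p.2)) L p.1) q := by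
  induction L with
  | nil => exact hg
  | cons k L ih =>
    refine ContDiffAt.clm_apply ?_ contDiffAt_const
    refine ContDiffAt.fderiv (f := fun (p : (Fin m → ℝ) × (Fin r → ℝ)) x' =>
      iterPartial (fun y => g (y, p.2)) L x') (g := fun p => p.1) (m := ∞) (n := ∞) ?_
      contDiffAt_fst (by simp)
    exact ContDiffAt.comp (g := fun p : (Fin m → ℝ) × (Fin r → ℝ) =>
      iterPartial (fun y => g (y, p.2)) L p.1)
      (f := fun p : ((Fin m → ℝ) × (Fin r → ℝ)) × (Fin m → ℝ) => (p.2, p.1.2)) (q, q.1) ih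
      (by fun_prop)

theorem contDiffAt_transformPt {f : (Fin m → ℝ) → (Fin n → ℝ)} {x h : Fin m → ℝ}
    {a : Fin r → ℝ} {g : (Fin m → ℝ) × (Fin r → ℝ) → (Fin n → ℝ)}
    (hd : ((x, f x, h), a) ∈ G.dom) (hg : ContDiffAt ℝ ∞ g (G.phi x (f x) a, a)) :
    ContDiffAt ℝ ∞ (G.transformPt N f x h g) a := by
  have h1 : ContDiffAt ℝ ∞ (fun a => G.phi x (f x) a) a :=
    ContDiffAt.comp (f := fun a => (x, f x, a))
      (g := fun p : (Fin m → ℝ) × (Fin n → ℝ) × (Fin r → ℝ) => G.phi p.1 p.2.1 p.2.2) a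
      (G.contDiffAt_phi hd) (by fun_prop)
  have h2 : ContDiffAt ℝ ∞ (fun a => G.psi x (f x) h a) a :=
    ContDiffAt.comp (f := fun a => (((x, f x, h), a) : Base m n × (Fin r → ℝ)))
      (g := fun p : Base m n × (Fin r → ℝ) => G.psi p.1.1 p.1.2.1 p.1.2.2 p.2) a
      (G.contDiffAt_psi hd) (by fun_prop)
  refine (h1.prodMk (contDiffAt_pi.2 fun K => ?_)).prodMk h2
  exact ContDiffAt.comp (f := fun a => (G.phi x (f x) a, a))
    (g := fun p : (Fin m → ℝ) × (Fin r → ℝ) => iterPartial (fun y => g (y, p.2)) _ p.1) a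
    (contDiffAt_iterPartial_param hg _) (h1.prodMk contDiffAt_id)

theorem eventually_prolongsTo_transformPt {f : (Fin m → ℝ) → (Fin n → ℝ)} {x h : Fin m → ℝ}
    {a₀ : Fin r → ℝ} (hf : ContDiffAt ℝ ∞ f x) (hd : ((x, f x, h), a₀) ∈ G.dom)
    (hi : (fderiv ℝ (fun y => G.phi y (f y) a₀) x).IsInvertible)
    {g : (Fin m → ℝ) × (Fin r → ℝ) → (Fin n → ℝ)}
    (hg : ∀ᶠ a in 𝓝 a₀, ContDiffAt ℝ ∞ g (G.phi x (f x) a, a))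
    (hgf : ∀ᶠ p in 𝓝 (x, a₀), g (G.phi p.1 (f p.1) p.2, p.2) = G.vphi p.1 (f p.1) p.2) :
    ∀ᶠ a in 𝓝 a₀, G.ProlongsTo N a (jetAt N f x, h) (G.transformPt N f x h g a) := by
  have hgf' : ∀ᶠ a in 𝓝 a₀, ∀ᶠ y in 𝓝 x, g (G.phi y (f y) a, a) = G.vphi y (f y) a := by
    have h1 : ∀ᶠ p in 𝓝 (a₀, x), g (G.phi p.2 (f p.2) p.1, p.1) = G.vphi p.2 (f p.2) p.1 :=
      (continuous_swap.tendsto (a₀, x)).eventually hgf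
    rw [nhds_prod_eq] at h1
    exact h1.curry
  have hdom : ∀ᶠ a in 𝓝 a₀, ((x, f x, h), a) ∈ G.dom :=
    G.eventually_mem_dom (q := fun a => ((x, f x, h), a)) (by fun_prop) hd
  filter_upwards [hgf', hdom, hg, G.eventually_isInvertible hf hd hi] with a h1 h2 h3 h4
  refine ⟨by rw [ExtJet.base, jetAt_val]; exact h2, by rw [jetAt_val]; rfl, f,
    fun y => g (y, a), hf, rfl, h4, ?_, h1, rfl⟩
  exact ContDiffAt.comp (f := fun y => (y, a)) (G.phi x (f x) a) h3 (by fun_prop)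

end StepGroup

/-! ### The infinitesimal transformation of jets -/

theorem fderiv_prod_left {E R F : Type*} [NormedAddCommGroup E] [NormedSpace ℝ E]
    [NormedAddCommGroup R] [NormedSpace ℝ R] [NormedAddCommGroup F] [NormedSpace ℝ F]
    {C : E × R → F} {y : E} {a : R} (hC : DifferentiableAt ℝ C (y, a)) (v : E) :
    fderiv ℝ C (y, a) (v, 0) = fderiv ℝ (fun y => C (y, a)) y v := by
  have h : HasFDerivAt (fun y => C (y, a)) _ y :=
    hC.hasFDerivAt.comp y (hasFDerivAt_prodMk_left y a)
  rw [h.fderiv]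
  simp

theorem fderiv_pi_apply {E : Type*} [NormedAddCommGroup E] [NormedSpace ℝ E] {k : ℕ}
    {F : E → Fin k → ℝ} {y : E} (hF : DifferentiableAt ℝ F y) (v : E) (j : Fin k) :
    fderiv ℝ F y v j = fderiv ℝ (fun y => F y j) y v := by
  rw [(hasFDerivAt_pi'.1 hF.hasFDerivAt j).fderiv]
  rfl

theorem fderiv_prod_right {E R F : Type*} [NormedAddCommGroup E] [NormedSpace ℝ E]
    [NormedAddCommGroup R] [NormedSpace ℝ R] [NormedAddCommGroup F] [NormedSpace ℝ F]
    {C : E × R → F} {y : E} {a : R} (hC : DifferentiableAt ℝ C (y, a)) (w : R) :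
    fderiv ℝ C (y, a) (0, w) = fderiv ℝ (fun a => C (y, a)) a w := by
  have h : HasFDerivAt (fun a => C (y, a)) _ a :=
    hC.hasFDerivAt.comp a (hasFDerivAt_prodMk_right y a)
  rw [h.fderiv]
  simp

/-- The mixed derivative of a function of two variables, computed in both orders. -/
theorem fderiv_fderiv_prod {E R F : Type*} [NormedAddCommGroup E] [NormedSpace ℝ E]
    [NormedAddCommGroup R] [NormedSpace ℝ R] [NormedAddCommGroup F] [NormedSpace ℝ F]
    {C : E × R → F} {y : E} {a : R} (hC : ContDiffAt ℝ 2 C (y, a)) (v : E) (w : R) :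
    fderiv ℝ (fun p => fderiv ℝ C p (v, 0)) (y, a) (0, w) =
      fderiv ℝ (fun y => fderiv ℝ C (y, a) (0, w)) y v := by
  rw [fderiv_fderiv_comm hC]
  refine fderiv_prod_left (C := fun p => fderiv ℝ C p (0, w)) ?_ v
  exact ((hC.fderiv_right (m := 1) (by norm_num)).differentiableAt (by simp)).clm_apply
    (differentiableAt_const _)

namespace StepGroup

variable {m n r N : ℕ} (G : StepGroup m n r)

theorem phi_zero {x h : Fin m → ℝ} {u : Fin n → ℝ} (hM : (x, u, h) ∈ G.M) : G.phi x u 0 = x :=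
  (Prod.ext_iff.1 (G.act_zero _ hM)).1

theorem vphi_zero {x h : Fin m → ℝ} {u : Fin n → ℝ} (hM : (x, u, h) ∈ G.M) : G.vphi x u 0 = u :=
  (Prod.ext_iff.1 (Prod.ext_iff.1 (G.act_zero _ hM)).2).1

theorem psi_zero {x h : Fin m → ℝ} {u : Fin n → ℝ} (hM : (x, u, h) ∈ G.M) : G.psi x u h 0 = h :=
  (Prod.ext_iff.1 (Prod.ext_iff.1 (G.act_zero _ hM)).2).2

theorem eventually_graph_mem_M {f : (Fin m → ℝ) → (Fin n → ℝ)} {x h : Fin m → ℝ}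
    (hf : ContDiffAt ℝ ∞ f x) (hM : (x, f x, h) ∈ G.M) : ∀ᶠ y in 𝓝 x, (y, f y, h) ∈ G.M :=
  (continuousAt_id.prodMk (hf.continuousAt.prodMk continuousAt_const)).eventually
    (G.isOpen_M.mem_nhds hM)

theorem fderiv_phi_graph_zero {f : (Fin m → ℝ) → (Fin n → ℝ)} {x h : Fin m → ℝ}
    (hf : ContDiffAt ℝ ∞ f x) (hM : (x, f x, h) ∈ G.M) :
    fderiv ℝ (fun y => G.phi y (f y) 0) x = ContinuousLinearMap.id ℝ _ := by
  have h1 : (fun y => G.phi y (f y) 0) =ᶠ[𝓝 x] id :=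
    (G.eventually_graph_mem_M hf hM).mono fun y hy => G.phi_zero hy
  rw [h1.fderiv_eq, fderiv_id]

theorem isInvertible_fderiv_phi_graph_zero {f : (Fin m → ℝ) → (Fin n → ℝ)} {x h : Fin m → ℝ}
    (hf : ContDiffAt ℝ ∞ f x) (hM : (x, f x, h) ∈ G.M) :
    (fderiv ℝ (fun y => G.phi y (f y) 0) x).IsInvertible := by
  rw [G.fderiv_phi_graph_zero hf hM]
  exact ⟨ContinuousLinearEquiv.refl ℝ _, rfl⟩

/-- The derivative `∂^L g (·, a)` at the transform of the point `(y, f y)`. -/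
def pullPartial (f : (Fin m → ℝ) → (Fin n → ℝ)) (g : (Fin m → ℝ) × (Fin r → ℝ) → (Fin n → ℝ))
    (L : List (Fin m)) (p : (Fin m → ℝ) × (Fin r → ℝ)) : Fin n → ℝ :=
  iterPartial (fun y => g (y, p.2)) L (G.phi p.1 (f p.1) p.2)

variable {f : (Fin m → ℝ) → (Fin n → ℝ)} {g : (Fin m → ℝ) × (Fin r → ℝ) → (Fin n → ℝ)}
  {x h : Fin m → ℝ}

theorem contDiffAt_pullPartial (hf : ContDiffAt ℝ ∞ f x) (hM : (x, f x, h) ∈ G.M)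
    (hg : ContDiffAt ℝ ∞ g (x, 0)) (L : List (Fin m)) :
    ContDiffAt ℝ ∞ (G.pullPartial f g L) (x, 0) := by
  refine ContDiffAt.comp (f := fun p => (G.phi p.1 (f p.1) p.2, p.2))
    (g := fun p : (Fin m → ℝ) × (Fin r → ℝ) => iterPartial (fun y => g (y, p.2)) L p.1) (x, 0)
    ?_ ((G.contDiffAt_phi_graph hf (G.zero_dom _ hM)).prodMk contDiffAt_snd)
  simp only [G.phi_zero hM]
  exact contDiffAt_iterPartial_param hg L

/-- The chain rule, stated for all p near (x, 0) so that it can then be differentiated in the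
parameter. -/
theorem fderiv_pullPartial (hf : ContDiffAt ℝ ∞ f x) (hM : (x, f x, h) ∈ G.M)
    (hg : ContDiffAt ℝ ∞ g (x, 0)) (L : List (Fin m)) (v : Fin m → ℝ) :
    ∀ᶠ p in 𝓝 (x, (0 : Fin r → ℝ)), fderiv ℝ (G.pullPartial f g L) p (v, 0) =
      ∑ i, fderiv ℝ (fun p : (Fin m → ℝ) × (Fin r → ℝ) => G.phi p.1 (f p.1) p.2) p (v, 0) i •
        G.pullPartial f g (i :: L) p := by
  have hΦ := G.contDiffAt_phi_graph hf (G.zero_dom _ hM)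
  have h1 : Tendsto (fun p : (Fin m → ℝ) × (Fin r → ℝ) => (G.phi p.1 (f p.1) p.2, p.2))
      (𝓝 (x, 0)) (𝓝 (x, 0)) := by
    have := (hΦ.continuousAt.prodMk continuousAt_snd).tendsto
    simpa only [G.phi_zero hM] using this
  filter_upwards [hΦ.eventually_differentiableAt,
    h1.eventually (contDiffAt_iterPartial_param hg L).eventually_differentiableAt]
    with p hp1 hp2
  have h2 : HasFDerivAt (G.pullPartial f g L) _ p :=
    HasFDerivAt.comp (f := fun p : (Fin m → ℝ) × (Fin r → ℝ) => (G.phi p.1 (f p.1) p.2, p.2))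
    (g := fun p : (Fin m → ℝ) × (Fin r → ℝ) => iterPartial (fun y => g (y, p.2)) L p.1) p
    hp2.hasFDerivAt (hp1.hasFDerivAt.prodMk hasFDerivAt_snd)
  rw [h2.fderiv]
  simp only [ContinuousLinearMap.comp_apply, ContinuousLinearMap.prod_apply,
    ContinuousLinearMap.coe_snd']
  rw [fderiv_prod_left hp2]
  set w := fderiv ℝ (fun p : (Fin m → ℝ) × (Fin r → ℝ) => G.phi p.1 (f p.1) p.2) p (v, 0)
  have h3 : w = ∑ i, w i • (Pi.single i 1 : Fin m → ℝ) := by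
    simpa using (pi_eq_sum_univ' w)
  conv_lhs => rw [h3, map_sum]
  simp only [map_smul]
  rfl

theorem fderiv_phi_graph_right (α : Fin r) (hf : ContDiffAt ℝ ∞ f x) (hM : (x, f x, h) ∈ G.M) :
    ∀ᶠ y in 𝓝 x, fderiv ℝ (fun p : (Fin m → ℝ) × (Fin r → ℝ) => G.phi p.1 (f p.1) p.2) (y, 0)
      (0, Pi.single α 1) = G.xi α y (f y) := by
  have h1 := (G.contDiffAt_phi_graph hf (G.zero_dom _ hM)).eventually_differentiableAt
  have h2 := (Continuous.prodMk_left (0 : Fin r → ℝ)).continuousAt.eventually h1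
  filter_upwards [h2] with y hy
  exact fderiv_prod_right hy _

theorem pullPartial_zero (hf : ContDiffAt ℝ ∞ f x) (hM : (x, f x, h) ∈ G.M)
    (hgf : ∀ᶠ p in 𝓝 (x, 0), g (G.phi p.1 (f p.1) p.2, p.2) = G.vphi p.1 (f p.1) p.2)
    (L : List (Fin m)) : ∀ᶠ y in 𝓝 x, G.pullPartial f g L (y, 0) = iterPartial f L y := by
  have h1 : (fun y => g (y, 0)) =ᶠ[𝓝 x] f := by
    have h2 := (Continuous.prodMk_left (0 : Fin r → ℝ)).continuousAt.eventually hgf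
    filter_upwards [h2, G.eventually_graph_mem_M hf hM] with y hy hyM
    simpa only [G.phi_zero hyM, G.vphi_zero hyM] using hy
  filter_upwards [iterPartial_congr h1 L, G.eventually_graph_mem_M hf hM] with y hy hyM
  simpa only [pullPartial, G.phi_zero hyM] using hy

/-- The infinitesimal change of the derivatives of `f` under the transformation of its graph. -/
theorem fderiv_pullPartial_param (α : Fin r) (hf : ContDiffAt ℝ ∞ f x) (hM : (x, f x, h) ∈ G.M)
    (hg : ContDiffAt ℝ ∞ g (x, 0))
    (hgf : ∀ᶠ p in 𝓝 (x, 0), g (G.phi p.1 (f p.1) p.2, p.2) = G.vphi p.1 (f p.1) p.2)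
    (L : List (Fin m)) (hL : L.length ≤ N) :
    ∀ᶠ y in 𝓝 x, ∀ j, fderiv ℝ (G.pullPartial f g L) (y, 0) (0, Pi.single α 1) j =
      G.sigma α N j L (jetAt N f y) := by
  have hcont : Tendsto (fun y : Fin m → ℝ => (y, (0 : Fin r → ℝ))) (𝓝 x) (𝓝 (x, 0)) :=
    (Continuous.prodMk_left (0 : Fin r → ℝ)).continuousAt
  induction L with
  | nil =>
    have h1 := hcont.eventually (contDiffAt_vphi_graph G hf
      (G.zero_dom _ hM)).eventually_differentiableAt
    filter_upwards [hcont.eventually (eventually_eventually_nhds.2 hgf), h1] with y hy1 hy2 j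
    have h3 : G.pullPartial f g [] =ᶠ[𝓝 (y, 0)] fun p => G.vphi p.1 (f p.1) p.2 := hy1
    rw [h3.fderiv_eq, fderiv_prod_right hy2]
    simp only [sigma, jetAt_val]
    rfl
  | cons k L ih =>
    simp only [List.length_cons] at hL
    have ih := ih (by omega)
    have hΦ := G.contDiffAt_phi_graph hf (G.zero_dom _ hM)
    have hC : ∀ L, ContDiffAt ℝ ∞ (G.pullPartial f g L) (x, 0) :=
      G.contDiffAt_pullPartial hf hM hg
    have e1 : ∀ᶠ y in 𝓝 x, ∀ i, G.pullPartial f g (i :: L) (y, 0) = iterPartial f (i :: L) y :=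
      eventually_all.2 fun i => G.pullPartial_zero hf hM hgf _
    have e2 : ∀ᶠ y in 𝓝 x, ∀ i, DifferentiableAt ℝ (G.pullPartial f g (i :: L)) (y, 0) :=
      eventually_all.2 fun i => hcont.eventually (hC _).eventually_differentiableAt
    have e3 : ∀ᶠ y in 𝓝 x, ∀ i, (jetAt N f y).coord (i ::ₘ (L : Multiset (Fin m))) =
        iterPartial f (i :: L) y :=
      eventually_all.2 fun i => coord_jetAt hf (i :: L) (by simpa using hL)
    filter_upwards [hcont.eventually (eventually_eventually_nhds.2
        (G.fderiv_pullPartial hf hM hg L (Pi.single k 1))), e1, e2, e3,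
      hcont.eventually (hΦ.eventually_nat 2), hcont.eventually ((hC L).eventually_nat 2),
      eventually_eventually_nhds.2 ih,
      eventually_eventually_nhds.2 (G.fderiv_phi_graph_right α hf hM),
      fderiv_comp_jetAt (N := N) hf k, G.eventually_graph_mem_M hf hM,
      eventually_eventually_nhds.2 (G.eventually_graph_mem_M hf hM)]
      with y hchain h1 h2 h3 hΦ2 hC2 hih hxi hD hyM hyM' j
    set Φ := fun p : (Fin m → ℝ) × (Fin r → ℝ) => G.phi p.1 (f p.1) p.2 with hΦdef
    have hΦd : DifferentiableAt ℝ (fun p => fderiv ℝ Φ p (Pi.single k 1, 0)) (y, 0) :=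
      ((hΦ2.fderiv_right (m := 1) (by norm_num)).differentiableAt (by simp)).clm_apply
        (differentiableAt_const _)
    -- differentiate the chain rule with respect to the parameter
    have hl : fderiv ℝ (fun p => fderiv ℝ (G.pullPartial f g L) p (Pi.single k 1, 0)) (y, 0)
        (0, Pi.single α 1) j = totalDeriv k (G.sigma α N j L) (jetAt N f y) := by
      have hd : DifferentiableAt ℝ
          (fun y => fderiv ℝ (G.pullPartial f g L) (y, 0) (0, Pi.single α 1)) y :=
        DifferentiableAt.comp (f := fun y => (y, (0 : Fin r → ℝ)))
          (g := fun p => fderiv ℝ (G.pullPartial f g L) p (0, Pi.single α 1)) y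
          (((hC2.fderiv_right (m := 1) (by norm_num)).differentiableAt (by simp)).clm_apply
            (differentiableAt_const _)) (by fun_prop)
      have he : (fun y => fderiv ℝ (G.pullPartial f g L) (y, 0) (0, Pi.single α 1) j) =ᶠ[𝓝 y]
          fun y => G.sigma α N j L (jetAt N f y) := hih.mono fun _ h => h j
      rw [fderiv_fderiv_prod hC2, fderiv_pi_apply hd, he.fderiv_eq]
      exact hD _ _ (G.hasOrder_sigma α j L) hL
        ((G.contDiffAt_sigma α j L (h := h) (by rwa [jetAt_val])).differentiableAt (by simp))
    have hr (i : Fin m) : fderiv ℝ (fun p => fderiv ℝ Φ p (Pi.single k 1, 0)) (y, 0)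
        (0, Pi.single α 1) i =
        totalDeriv k (fun w : Jet m n N => G.xi α w.1 w.val i) (jetAt N f y) := by
      have hd : DifferentiableAt ℝ (fun y => fderiv ℝ Φ (y, 0) (0, Pi.single α 1)) y :=
        DifferentiableAt.comp (f := fun y => (y, (0 : Fin r → ℝ)))
          (g := fun p => fderiv ℝ Φ p (0, Pi.single α 1)) y
          (((hΦ2.fderiv_right (m := 1) (by norm_num)).differentiableAt (by simp)).clm_apply
            (differentiableAt_const _)) (by fun_prop)
      have he : (fun y => fderiv ℝ Φ (y, 0) (0, Pi.single α 1) i) =ᶠ[𝓝 y]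
          fun y => G.xi α (jetAt N f y).1 (jetAt N f y).val i :=
        hxi.mono fun z hz => by
            simp only [hz, jetAt_val]; rfl
      rw [fderiv_fderiv_prod hΦ2, fderiv_pi_apply hd, he.fderiv_eq]
      exact hD 0 _ (HasOrder.of_val fun x u => G.xi α x u i) (by omega)
        ((contDiffAt_pi.1 (G.contDiffAt_xi_jet α (h := h) (by rwa [jetAt_val])) i).differentiableAt
          (by simp))
    -- At the identity parameter Φ is the identity map in y.
    have hid : fderiv ℝ Φ (y, 0) (Pi.single k 1, 0) = Pi.single k 1 := by
      have he : (fun y => Φ (y, 0)) =ᶠ[𝓝 y] id := hyM'.mono fun z hz => G.phi_zero hz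
      rw [fderiv_prod_left (hΦ2.differentiableAt (by simp)), he.fderiv_eq, fderiv_id]
      rfl
    have hsum : HasFDerivAt (fun p => ∑ i, fderiv ℝ Φ p (Pi.single k 1, 0) i •
        G.pullPartial f g (i :: L) p) _ (y, 0) :=
      HasFDerivAt.fun_sum fun i _ => (hasFDerivAt_pi'.1 hΦd.hasFDerivAt i).smul (h2 i).hasFDerivAt
    -- The left side is D_k σ^L after exchanging the derivatives; the product rule splits the right
    -- side into the D_k ξ_i terms and the wanted parameter derivative for k :: L. Solving for the
    -- latter is the recursion.
    have key := congrArg (fun T => T (0, Pi.single α 1) j) (EventuallyEq.fderiv_eq (𝕜 := ℝ) hchain)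
    rw [hl, hsum.fderiv] at key
    simp only [ContinuousLinearMap.comp_apply, sum_apply,
      add_apply, smul_apply, ContinuousLinearMap.smulRight_apply,
      Finset.sum_apply, Pi.add_apply, Pi.smul_apply, smul_eq_mul, hid] at key
    simp only [ContinuousLinearMap.proj_apply, hr, h1, Finset.sum_add_distrib] at key
    rw [Finset.sum_eq_single k (fun i _ hi => by simp [Pi.single_eq_of_ne hi]) (by simp),
      Pi.single_eq_same, one_mul] at key
    simp only [sigma, key, h3]
    rw [add_sub_assoc, ← Finset.sum_sub_distrib]
    simp [mul_comm]

theorem exists_transform_zero (hf : ContDiffAt ℝ ∞ f x) (hM : (x, f x, h) ∈ G.M) :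
    ∃ g : (Fin m → ℝ) × (Fin r → ℝ) → (Fin n → ℝ), ContDiffAt ℝ ∞ g (x, 0) ∧
      (∀ᶠ p in 𝓝 (x, 0), g (G.phi p.1 (f p.1) p.2, p.2) = G.vphi p.1 (f p.1) p.2) ∧
      ∀ᶠ a in 𝓝 0, G.ProlongsTo N a (jetAt N f x, h) (G.transformPt N f x h g a) := by
  have hi := G.isInvertible_fderiv_phi_graph_zero hf hM
  obtain ⟨g, hg, hgf⟩ := G.exists_transform hf (G.zero_dom _ hM) hi
  refine ⟨g, ?_, hgf, G.eventually_prolongsTo_transformPt hf (G.zero_dom _ hM) hi hg hgf⟩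
  simpa only [G.phi_zero hM] using hg.self_of_nhds

/-- The prolonged infinitesimal operator is the derivative of the prolonged transformation. -/
theorem fderiv_transformPt (α : Fin r) (hf : ContDiffAt ℝ ∞ f x) (hM : (x, f x, h) ∈ G.M)
    (hg : ContDiffAt ℝ ∞ g (x, 0))
    (hgf : ∀ᶠ p in 𝓝 (x, 0), g (G.phi p.1 (f p.1) p.2, p.2) = G.vphi p.1 (f p.1) p.2) :
    fderiv ℝ (G.transformPt N f x h g) 0 (Pi.single α 1) =
      (G.prolongField α N (jetAt N f x), G.zeta α x (f x) h) := by
  have hd : HasFDerivAt (G.transformPt N f x h g) (fderiv ℝ (G.transformPt N f x h g) 0) 0 :=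
    ((G.contDiffAt_transformPt (G.zero_dom _ hM) (by rwa [G.phi_zero hM])).differentiableAt
      (by simp)).hasFDerivAt
  have h1 : HasFDerivAt (fun a => G.phi x (f x) a) _ 0 := hd.fst.fst
  have h2 : HasFDerivAt (fun a => G.psi x (f x) h a) _ 0 := hd.snd
  refine Prod.ext (Prod.ext ?_ (funext fun K => funext fun j => ?_)) ?_
  · simp only [prolongField, xi, jetAt_val]
    change _ = fderiv ℝ (fun a => G.phi x (f x) a) 0 (Pi.single α 1)
    rw [h1.fderiv]
    rfl
  · have h3 : HasFDerivAt (fun a => G.pullPartial f g (K.1.sort (· ≤ ·)) (x, a)) _ 0 :=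
      hasFDerivAt_pi'.1 hd.fst.snd K
    have h4 := (G.fderiv_pullPartial_param (N := N) α hf hM hg hgf (K.1.sort (· ≤ ·))
      (by simpa using K.2)).self_of_nhds j
    rw [fderiv_prod_right ((G.contDiffAt_pullPartial hf hM hg _).differentiableAt (by simp)),
      h3.fderiv] at h4
    exact h4
  · simp only [zeta]
    rw [h2.fderiv]
    rfl

/-- The coefficients of the prolonged operator do not depend on the order of the jet space. -/
theorem prolongField_trunc (α : Fin r) {l : ℕ} (hl : l ≤ N) {z : Jet m n N}
    (hM : (z.1, z.val, h) ∈ G.M) :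
    G.prolongField α l (z.trunc l) = (G.prolongField α N z).trunc l := by
  obtain ⟨f, hf, hz⟩ := exists_jetAt_eq z
  obtain ⟨x, w⟩ := z
  dsimp only at hz
  have hw : ∀ K : Multiset (Fin m), K.card ≤ N →
      (jetAt N f x).coord K = iterPartial f (K.sort (· ≤ ·)) x := fun K hK => by
    unfold Jet.coord
    rw [dif_pos hK]
    rfl
  have ht : (jetAt N f x).trunc l = jetAt l f x :=
    Prod.ext rfl (funext fun K => hw K.1 (K.2.trans hl))
  rw [← hz] at hM ⊢
  rw [jetAt_val] at hM
  rw [ht]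
  obtain ⟨g, hg, hgf, -⟩ := G.exists_transform_zero (N := N) hf.contDiffAt hM
  refine Prod.ext ?_ (funext fun K => funext fun j => ?_)
  · simp only [prolongField, Jet.trunc, jetAt_val]
    rfl
  · have hK : K.1.card ≤ N := K.2.trans hl
    -- Both coefficients are the same parameter derivative of `pullPartial`, which does not mention
    -- the order of the jet space.
    have h1 := (G.fderiv_pullPartial_param (N := N) α hf.contDiffAt hM hg hgf
      (K.1.sort (· ≤ ·)) (by simpa using hK)).self_of_nhds j
    have h2 := (G.fderiv_pullPartial_param (N := l) α hf.contDiffAt hM hg hgf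
      (K.1.sort (· ≤ ·)) (by simpa using K.2)).self_of_nhds j
    simp only [prolongField, Jet.trunc, Jet.coord, hK, dif_pos]
    exact h2.symm.trans h1

end StepGroup

/-! ### Functions vanishing on a regular zero set -/

/-- A `C¹` function that vanishes on the zero set of a submersion `P` is bounded by a multiple
of `P`. -/
theorem exists_norm_le_of_vanishing {E F H : Type*} [NormedAddCommGroup E] [NormedSpace ℝ E]
    [CompleteSpace E] [NormedAddCommGroup F] [NormedSpace ℝ F] [CompleteSpace F]
    [NormedAddCommGroup H] [NormedSpace ℝ H] {P : E → F} {P' : E →L[ℝ] F} {Q : E → H} {p : E}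
    (hP : HasStrictFDerivAt P P' p) (hs : Function.Surjective P') (h0 : P p = 0)
    (hQ : ContDiffAt ℝ 1 Q p) (hPQ : ∀ᶠ q in 𝓝 p, P q = 0 → Q q = 0) :
    ∃ C : ℝ, 0 ≤ C ∧ ∀ᶠ q in 𝓝 p, ‖Q q‖ ≤ C * ‖P q‖ := by
  have hs' : P'.range = ⊤ := LinearMap.range_eq_top.2 hs
  set R := P'.nonlinearRightInverseOfSurjective hs'
  have hR : 0 < R.nnnorm := P'.nonlinearRightInverseOfSurjective_nnnorm_pos hs'
  -- Half the admissible error, so that the surjectivity constant ‖R‖⁻¹ - c equals c.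
  set c : NNReal := R.nnnorm⁻¹ / 2 with hc
  have hc0 : 0 < c := by positivity
  obtain ⟨s, hsp, hsP⟩ := hP.approximates_deriv_on_nhds (c := c) (Or.inr hc0)
  obtain ⟨K, t, htp, htQ⟩ := hQ.exists_lipschitzOnWith
  obtain ⟨δ, hδ, hball⟩ := Metric.mem_nhds_iff.1 (inter_mem (inter_mem hsp htp) hPQ)
  have hcR : (0 : ℝ) < c := hc0
  refine ⟨K * (c : ℝ)⁻¹, by positivity, ?_⟩
  have hPc : Tendsto (fun q => (c : ℝ)⁻¹ * ‖P q‖) (𝓝 p) (𝓝 0) := by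
    have := (hP.continuousAt.norm.const_mul (c : ℝ)⁻¹).tendsto
    simpa [h0] using this
  filter_upwards [hPc.eventually (gt_mem_nhds (half_pos hδ)), Metric.ball_mem_nhds p (half_pos hδ)]
    with q hq1 hq2
  -- The ε-ball about q covers the ball of radius cε = ‖P q‖ about P q, which just reaches 0: there
  -- is a zero q' of P within ε of q, and the Lipschitz bound for Q compares q with q'.
  set ε := (c : ℝ)⁻¹ * ‖P q‖ with hε
  have hε0 : 0 ≤ ε := by positivity
  have hsub : Metric.closedBall q ε ⊆ Metric.ball p δ := by
    intro q' hq'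
    have h1 := dist_triangle q' q p
    rw [Metric.mem_closedBall] at hq'
    rw [Metric.mem_ball] at hq2 ⊢
    linarith
  have h2 : (0 : F) ∈ Metric.closedBall (P q) (((R.nnnorm : ℝ)⁻¹ - c) * ε) := by
    have h3 : (R.nnnorm : ℝ)⁻¹ - c = c := by rw [hc]; push_cast; ring
    rw [Metric.mem_closedBall, dist_zero_left, h3, hε, mul_inv_cancel_left₀ hcR.ne']
  obtain ⟨q', hq', hPq'⟩ := hsP.surjOn_closedBall_of_nonlinearRightInverse R hε0
    (hsub.trans fun y hy => (hball hy).1.1) h2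
  have hQq' : Q q' = 0 := (hball (hsub hq')).2 hPq'
  have h4 := htQ.dist_le_mul q (hball (hsub (Metric.mem_closedBall_self hε0))).1.2 q'
    (hball (hsub hq')).1.2
  rw [hQq', dist_zero_right] at h4
  rw [Metric.mem_closedBall, dist_comm] at hq'
  calc ‖Q q‖ ≤ K * dist q q' := h4
    _ ≤ K * ε := by gcongr
    _ = K * (c : ℝ)⁻¹ * ‖P q‖ := by rw [hε]; ring

/-! ### The prolonged transformations form a local group -/

namespace LocalLieGroup

variable {r : ℕ} (G : LocalLieGroup r)

theorem contDiffAt_mul_inv {a : Fin r → ℝ} (ha : a ∈ G.V) :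
    ContDiffAt ℝ ∞ (fun p : (Fin r → ℝ) × (Fin r → ℝ) => G.mul p.1 (G.inv p.2)) (a, a) := by
  have h1 : ContDiffAt ℝ ∞ G.inv a := G.contDiffOn_inv.contDiffAt (G.isOpen_V.mem_nhds ha)
  have h2 : ContDiffAt ℝ ∞ (fun p : (Fin r → ℝ) × (Fin r → ℝ) => G.mul p.1 p.2) (a, G.inv a) :=
    G.contDiffOn_mul.contDiffAt
      ((G.isOpen_V.prod G.isOpen_V).mem_nhds ⟨ha, G.inv_mem a ha⟩)
  exact ContDiffAt.comp (f := fun p : (Fin r → ℝ) × (Fin r → ℝ) => (p.1, G.inv p.2))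
    (g := fun p : (Fin r → ℝ) × (Fin r → ℝ) => G.mul p.1 p.2) (a, a) h2
    (contDiffAt_fst.prodMk (ContDiffAt.comp (a, a) h1 contDiffAt_snd))

theorem contDiffAt_mul_inv_left {a : Fin r → ℝ} (ha : a ∈ G.V) :
    ContDiffAt ℝ ∞ (fun a' => G.mul a' (G.inv a)) a :=
  ContDiffAt.comp (f := fun a' => (a', a))
    (g := fun p : (Fin r → ℝ) × (Fin r → ℝ) => G.mul p.1 (G.inv p.2)) a
    (G.contDiffAt_mul_inv ha) (by fun_prop)

theorem tendsto_mul_inv {a : Fin r → ℝ} (ha : a ∈ G.V) :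
    Tendsto (fun a' => G.mul a' (G.inv a)) (𝓝 a) (𝓝 0) := by
  have h := (G.contDiffAt_mul_inv_left ha).continuousAt.tendsto
  rwa [G.mul_inv a ha] at h

/-- Associativity is available only when the partial products lie in V; a' a⁻¹ does for a' near a,
because it tends to 0. -/
theorem eventually_mul_inv_mul {a : Fin r → ℝ} (ha : a ∈ G.V) :
    ∀ᶠ a' in 𝓝 a, G.mul (G.mul a' (G.inv a)) a = a' := by
  filter_upwards [G.isOpen_V.mem_nhds ha,
    (G.tendsto_mul_inv ha).eventually (G.isOpen_V.mem_nhds G.zero_mem)] with a' h1 h2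
  rw [G.assoc a' h1 _ (G.inv_mem a ha) a ha h2 (by rw [G.inv_mul a ha]; exact G.zero_mem),
    G.inv_mul a ha, G.mul_zero a' h1]

/-- These are partial derivatives, on the diagonal, of one smooth map of two variables, hence
locally bounded. This makes the Grönwall constant uniform. -/
theorem exists_norm_fderiv_mul_inv_le {a₀ : Fin r → ℝ} (ha : a₀ ∈ G.V) :
    ∃ B : ℝ, 0 ≤ B ∧ ∀ᶠ a in 𝓝 a₀, ∀ v,
      ‖fderiv ℝ (fun a' => G.mul a' (G.inv a)) a v‖ ≤ B * ‖v‖ := by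
  set M := fun p : (Fin r → ℝ) × (Fin r → ℝ) => G.mul p.1 (G.inv p.2)
  have h1 : ContinuousAt (fun a => ‖fderiv ℝ M (a, a)‖) a₀ :=
    ContinuousAt.norm (ContinuousAt.comp (f := fun a => (a, a)) (g := fderiv ℝ M)
      ((G.contDiffAt_mul_inv ha).fderiv_right (m := ∞) (by simp)).continuousAt (by fun_prop))
  refine ⟨‖fderiv ℝ M (a₀, a₀)‖ + 1, by positivity, ?_⟩
  filter_upwards [h1.eventually (gt_mem_nhds (lt_add_one _)), G.isOpen_V.mem_nhds ha] with a h2 h3 v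
  rw [← fderiv_prod_left (C := M) ((G.contDiffAt_mul_inv h3).differentiableAt (by simp))]
  refine (ContinuousLinearMap.le_opNorm _ _).trans ?_
  have h4 : ‖((v, 0) : (Fin r → ℝ) × (Fin r → ℝ))‖ = ‖v‖ := by simp [Prod.norm_def]
  rw [h4]
  gcongr

end LocalLieGroup

namespace StepGroup

variable {m n r N : ℕ} (G : StepGroup m n r)

/-- The prolonged infinitesimal operator as a vector field. -/
def extField (α : Fin r) (p : ExtJet m n N) : ExtJet m n N :=
  (G.prolongField α N p.1, G.zeta α p.1.1 p.1.val p.2)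

theorem ProlongsTo.base_mem {G : StepGroup m n r} {a : Fin r → ℝ} {p p' : ExtJet m n N}
    (h : G.ProlongsTo N a p p') : p.base ∈ G.M := (G.mem_of_dom _ _ h.1).1

theorem ProlongsTo.eq_of_zero {G : StepGroup m n r} {p p' : ExtJet m n N}
    (h : G.ProlongsTo N 0 p p') : p' = p := by
  have hM := h.base_mem
  obtain ⟨-, hp, f, g, hf, hj, -, -, he, hk⟩ := h
  obtain ⟨⟨x, w⟩, h⟩ := p
  dsimp only at *
  have hu : f x = Jet.val ((x, w) : Jet m n N) := by rw [← hj, jetAt_val]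
  have hM' : (x, f x, h) ∈ G.M := by rw [hu]; exact hM
  rw [G.phi_zero hM'] at hk
  rw [← hu, G.psi_zero hM'] at hp
  refine Prod.ext ?_ hp
  rw [← hk, ← hj]
  have hgf : g =ᶠ[𝓝 x] f := by
    filter_upwards [he, G.eventually_graph_mem_M hf hM'] with y hy hyM
    rwa [G.phi_zero hyM, G.vphi_zero hyM] at hy
  exact Prod.ext rfl (funext fun K => (iterPartial_congr hgf _).self_of_nhds)

variable {f : (Fin m → ℝ) → (Fin n → ℝ)} {x h : Fin m → ℝ} {a a₀ : Fin r → ℝ}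

/-- Transforming the transform with parameter `a` by `a' a⁻¹` gives the transform with
parameter `a'`. -/
theorem exists_prolongsTo_mul_inv (hf : ContDiffAt ℝ ∞ f x) (hd : ((x, f x, h), a) ∈ G.dom)
    (hi : (fderiv ℝ (fun y => G.phi y (f y) a) x).IsInvertible)
    {g : (Fin m → ℝ) → (Fin n → ℝ)} (hg : ContDiffAt ℝ ∞ g (G.phi x (f x) a))
    (hgf : ∀ᶠ y in 𝓝 x, g (G.phi y (f y) a) = G.vphi y (f y) a) :
    ∃ Z : (Fin r → ℝ) → ExtJet m n N, DifferentiableAt ℝ Z 0 ∧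
      (∀ α, fderiv ℝ Z 0 (Pi.single α 1) =
        G.extField α (jetAt N g (G.phi x (f x) a), G.psi x (f x) h a)) ∧
      ∀ᶠ a' in 𝓝 a, G.ProlongsTo N a' (jetAt N f x, h) (Z (G.mul a' (G.inv a))) := by
  have haV : a ∈ G.V := (G.mem_of_dom _ _ hd).2
  have hgx := hgf.self_of_nhds
  have hact : G.act (x, f x, h) a = (G.phi x (f x) a, g (G.phi x (f x) a), G.psi x (f x) h a) := by
    rw [hgx]; rfl
  have hM : (G.phi x (f x) a, g (G.phi x (f x) a), G.psi x (f x) h a) ∈ G.M := by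
    rw [← hact]; exact G.act_mem _ _ hd
  have hi0 := G.isInvertible_fderiv_phi_graph_zero hg hM
  have hd0 := G.zero_dom _ hM
  -- Here k(·, b) is the transform of g by a parameter b near the identity; b = a' a⁻¹ will be used.
  obtain ⟨k, hk, hkg⟩ := G.exists_transform hg hd0 hi0
  have hk0 : ContDiffAt ℝ ∞ k (G.phi x (f x) a, 0) := by
    simpa only [G.phi_zero hM] using hk.self_of_nhds
  refine ⟨G.transformPt N g (G.phi x (f x) a) (G.psi x (f x) h a) k,
    (G.contDiffAt_transformPt hd0 (by rwa [G.phi_zero hM])).differentiableAt (by simp),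
    fun α => ?_, ?_⟩
  · rw [G.fderiv_transformPt α hg hM hk0 hkg, extField, jetAt_val]
    rfl
  have hkg' : ∀ᶠ b in 𝓝 0, ∀ᶠ y in 𝓝 (G.phi x (f x) a),
      k (G.phi y (g y) b, b) = G.vphi y (g y) b := by
    have h1 := (continuous_swap.tendsto ((0 : Fin r → ℝ), G.phi x (f x) a)).eventually hkg
    rw [nhds_prod_eq] at h1
    exact h1.curry
  have hb := G.tendsto_mul_inv haV
  filter_upwards [hb.eventually hkg', hb.eventually hk, G.eventually_mul_inv_mul haV,
    G.eventually_mem_dom (q := fun a => ((x, f x, h), a)) (by fun_prop) hd,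
    hb.eventually (G.eventually_mem_dom (q := fun b => (G.act (x, f x, h) a, b)) (by fun_prop)
      (by rw [hact]; exact hd0)),
    G.eventually_isInvertible hf hd hi] with a' h1 h2 h3 h4 h5 h6
  set b := G.mul a' (G.inv a)
  have hpair : ContinuousAt (fun y => (((y, f y, h), a) : Base m n × (Fin r → ℝ))) x :=
    (continuousAt_id.prodMk (hf.continuousAt.prodMk continuousAt_const)).prodMk continuousAt_const
  have hcomp : ∀ y, ((y, f y, h), a) ∈ G.dom → (G.act (y, f y, h) a, b) ∈ G.dom →
      ((y, f y, h), a') ∈ G.dom → g (G.phi y (f y) a) = G.vphi y (f y) a →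
      G.phi (G.phi y (f y) a) (g (G.phi y (f y) a)) b = G.phi y (f y) a' ∧
      G.vphi (G.phi y (f y) a) (g (G.phi y (f y) a)) b = G.vphi y (f y) a' ∧
      G.psi (G.phi y (f y) a) (g (G.phi y (f y) a)) (G.psi y (f y) h a) b =
        G.psi y (f y) h a' := by
    intro y e1 e2 e3 e4
    have e5 := G.act_act _ _ _ e1 e2 (by rw [h3]; exact e3)
    rw [h3] at e5
    rw [e4]
    exact ⟨(Prod.ext_iff.1 e5).1, (Prod.ext_iff.1 (Prod.ext_iff.1 e5).2).1,
      (Prod.ext_iff.1 (Prod.ext_iff.1 e5).2).2⟩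
  obtain ⟨c1, c2, c3⟩ := hcomp x hd h5 h4 hgx
  refine ⟨by rw [ExtJet.base, jetAt_val]; exact h4, ?_, f, fun y => k (y, b), hf, rfl, h6,
    ?_, ?_, ?_⟩
  · rw [jetAt_val]; exact c3
  · rw [c1] at h2
    exact ContDiffAt.comp (f := fun y => (y, b)) (G.phi x (f x) a') h2 (by fun_prop)
  · have hphi : ContinuousAt (fun y => G.phi y (f y) a) x :=
      ContinuousAt.comp (f := fun y => (y, a))
        (g := fun p : (Fin m → ℝ) × (Fin r → ℝ) => G.phi p.1 (f p.1) p.2)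
        (G.contDiffAt_phi_graph hf hd).continuousAt (by fun_prop)
    have hactc : ContinuousAt (fun y => (G.act (y, f y, h) a, b)) x :=
      ContinuousAt.prodMk (ContinuousAt.comp
        (f := fun y => (((y, f y, h), a) : Base m n × (Fin r → ℝ)))
        (g := fun p : Base m n × (Fin r → ℝ) => G.act p.1 p.2)
        (G.contDiffAt_act hd).continuousAt hpair) continuousAt_const
    have hpair' : ContinuousAt (fun y => (((y, f y, h), a') : Base m n × (Fin r → ℝ))) x :=
      (continuousAt_id.prodMk (hf.continuousAt.prodMk continuousAt_const)).prodMk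
        continuousAt_const
    filter_upwards [hphi.eventually h1, hgf, G.eventually_mem_dom hpair hd,
      G.eventually_mem_dom hactc h5, G.eventually_mem_dom hpair' h4] with y y1 y2 y3 y4 y5
    obtain ⟨d1, d2, -⟩ := hcomp y y3 y4 y5 y2
    rwa [d1, d2] at y1
  · simp only [transformPt, c1]
    rfl

/-- The transforms of a point satisfy the differential equations of the prolonged group. -/
theorem fderiv_transformPt_param (hf : ContDiffAt ℝ ∞ f x) (hd : ((x, f x, h), a₀) ∈ G.dom)
    (hi : (fderiv ℝ (fun y => G.phi y (f y) a₀) x).IsInvertible)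
    {g : (Fin m → ℝ) × (Fin r → ℝ) → (Fin n → ℝ)}
    (hg : ∀ᶠ a in 𝓝 a₀, ContDiffAt ℝ ∞ g (G.phi x (f x) a, a))
    (hgf : ∀ᶠ p in 𝓝 (x, a₀), g (G.phi p.1 (f p.1) p.2, p.2) = G.vphi p.1 (f p.1) p.2) :
    ∀ᶠ a in 𝓝 a₀, ∀ v, fderiv ℝ (G.transformPt N f x h g) a v =
      ∑ α, fderiv ℝ (fun a' => G.mul a' (G.inv a)) a v α •
        G.extField α (G.transformPt N f x h g a) := by
  have hgf' : ∀ᶠ a in 𝓝 a₀, ∀ᶠ y in 𝓝 x, g (G.phi y (f y) a, a) = G.vphi y (f y) a := by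
    have h1 := (continuous_swap.tendsto (a₀, x)).eventually hgf
    rw [nhds_prod_eq] at h1
    exact h1.curry
  filter_upwards [hgf', hg, eventually_eventually_nhds.2
    (G.eventually_prolongsTo_transformPt (N := N) hf hd hi hg hgf),
    G.eventually_mem_dom (q := fun a => ((x, f x, h), a)) (by fun_prop) hd,
    G.eventually_isInvertible hf hd hi] with a h1 h2 h3 h4 h5 v
  obtain ⟨Z, hZ, hZ', hZp⟩ := G.exists_prolongsTo_mul_inv (N := N) hf h4 h5
    (g := fun y => g (y, a))
    (ContDiffAt.comp (f := fun y => (y, a)) (G.phi x (f x) a) h2 (by fun_prop)) h1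
  have haV : a ∈ G.V := (G.mem_of_dom _ _ h4).2
  -- By uniqueness the transforms with a' near a are obtained from the one with a by parameters near
  -- 0, where the derivative is already known.
  have he : G.transformPt N f x h g =ᶠ[𝓝 a] fun a' => Z (G.mul a' (G.inv a)) := by
    filter_upwards [h3, hZp] with a' e1 e2
    exact e1.unique e2
  have hc : HasFDerivAt (fun a' => Z (G.mul a' (G.inv a))) _ a :=
    HasFDerivAt.comp (g := Z) (f := fun a' => G.mul a' (G.inv a)) a
      (by rw [G.mul_inv a haV]; exact hZ.hasFDerivAt)
      ((G.contDiffAt_mul_inv_left haV).differentiableAt (by simp)).hasFDerivAt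
  rw [he.fderiv_eq, hc.fderiv, ContinuousLinearMap.comp_apply]
  set w := fderiv ℝ (fun a' => G.mul a' (G.inv a)) a v
  have h6 : w = ∑ i, w i • (Pi.single i 1 : Fin r → ℝ) := by simpa using (pi_eq_sum_univ' w)
  conv_lhs => rw [h6, map_sum]
  simp only [map_smul, hZ']
  rfl

end StepGroup

/-! ### The infinitesimal criterion of invariance -/

namespace StepGroup

variable {m n r N q : ℕ} (G : StepGroup m n r)

/-- A zero of the system that is reached by a transform stays a zero for all parameters nearby. -/
theorem eventually_zero_of_zero {Ω : Set (ExtJet m n N)} {P : ExtJet m n N → Fin q → ℝ}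
    (hΩ : IsOpen Ω) (hΩM : ∀ p ∈ Ω, p.base ∈ G.M) (hP : ContDiffOn ℝ ∞ P Ω)
    (hrank : ∀ p ∈ Ω, P p = 0 → Function.Surjective (fderiv ℝ P p))
    (hinf : ∀ p ∈ Ω, P p = 0 → ∀ α, fderiv ℝ P p (G.extField α p) = 0)
    {p p₀ : ExtJet m n N} {a₀ : Fin r → ℝ} (hp : G.ProlongsTo N a₀ p p₀) (hp₀ : p₀ ∈ Ω)
    (h0 : P p₀ = 0) : ∀ᶠ a in 𝓝 a₀, ∀ p', G.ProlongsTo N a p p' → P p' = 0 := by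
  have hp' := hp
  obtain ⟨hd, -, f, -, hf, hj, hi, -⟩ := hp
  obtain ⟨⟨x, w⟩, h⟩ := p
  dsimp only at hf hj hi
  have hd' : ((x, f x, h), a₀) ∈ G.dom := by rw [← jetAt_val (N := N) f x, hj]; exact hd
  obtain ⟨g, hg, hgf⟩ := G.exists_transform hf hd' hi
  set Z := G.transformPt N f x h g with hZdef
  have hZp : ∀ᶠ a in 𝓝 a₀, G.ProlongsTo N a ((x, w), h) (Z a) := by
    rw [← hj]
    exact G.eventually_prolongsTo_transformPt hf hd' hi hg hgf
  have hZ0 : Z a₀ = p₀ := hZp.self_of_nhds.unique hp'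
  have hZs : ContDiffAt ℝ ∞ Z a₀ := G.contDiffAt_transformPt hd' hg.self_of_nhds
  have hPs : ∀ p ∈ Ω, ContDiffAt ℝ ∞ P p := fun p hp => hP.contDiffAt (hΩ.mem_nhds hp)
  have hQ : ContDiffAt ℝ 1 (fun p => fun α => fderiv ℝ P p (G.extField α p)) p₀ := by
    refine contDiffAt_pi.2 fun α => ?_
    refine ((hPs _ hp₀).fderiv_right (m := ∞) (by simp)).of_le (by exact_mod_cast le_top)
      |>.clm_apply ?_
    exact (G.contDiffAt_prolongField α (hΩM _ hp₀)).of_le (by exact_mod_cast le_top)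
  -- Maximal rank enters here: the L_α P vanish on the zero set, hence are bounded by C‖P‖ also off
  -- it.
  obtain ⟨C, hC, hQC⟩ := exists_norm_le_of_vanishing
    ((hPs _ hp₀).hasStrictFDerivAt (by simp)) (hrank _ hp₀ h0) h0 hQ
    (by filter_upwards [hΩ.mem_nhds hp₀] with p hp hp0 using funext fun α => hinf p hp hp0 α)
  obtain ⟨B, hB, hBv⟩ := G.exists_norm_fderiv_mul_inv_le (G.mem_of_dom _ _ hd').2
  have hZc : Tendsto Z (𝓝 a₀) (𝓝 p₀) := by rw [← hZ0]; exact hZs.continuousAt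
  have hall := (hZc.eventually hQC).and ((hZc.eventually (hΩ.mem_nhds hp₀)).and
    (hBv.and (hZp.and (hZs.eventually_differentiableAt.and
      (G.fderiv_transformPt_param (N := N) hf hd' hi hg hgf)))))
  obtain ⟨δ, hδ, hball⟩ := Metric.eventually_nhds_iff_ball.1 hall
  refine Metric.eventually_nhds_iff_ball.2 ⟨δ, hδ, fun a ha p' hap' => ?_⟩
  rw [← (hball a ha).2.2.2.1.unique hap']
  set v := a - a₀ with hv
  have hseg : ∀ t ∈ Icc (0 : ℝ) 1, a₀ + t • v ∈ Metric.ball a₀ δ := by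
    intro t ht
    rw [Metric.mem_ball, dist_eq_norm] at ha ⊢
    rw [add_sub_cancel_left, norm_smul, Real.norm_of_nonneg ht.1]
    exact (mul_le_of_le_one_left (norm_nonneg _) ht.2).trans_lt ha
  have hder : ∀ t ∈ Icc (0 : ℝ) 1, HasDerivAt (fun t : ℝ => P (Z (a₀ + t • v)))
      (fderiv ℝ P (Z (a₀ + t • v)) (fderiv ℝ Z (a₀ + t • v) v)) t := by
    intro t ht
    obtain ⟨-, h2, -, -, h5, -⟩ := hball _ (hseg t ht)
    have e1 : HasDerivAt (fun t : ℝ => a₀ + t • v) v t := by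
      simpa using ((hasDerivAt_id t).smul_const v).const_add a₀
    have e2 := h5.hasFDerivAt.comp_hasDerivAt t e1
    exact ((hPs _ h2).differentiableAt (by simp)).hasFDerivAt.comp_hasDerivAt t e2
  -- There are r terms, each with a coefficient at most B‖v‖ and a factor L_α P at most C‖P‖.
  have hbound : ∀ t ∈ Icc (0 : ℝ) 1,
      ‖fderiv ℝ P (Z (a₀ + t • v)) (fderiv ℝ Z (a₀ + t • v) v)‖ ≤
        (r * (B * ‖v‖ * C)) * ‖P (Z (a₀ + t • v))‖ := by
    intro t ht
    obtain ⟨h1, -, h3, -, -, h6⟩ := hball _ (hseg t ht)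
    rw [h6 v, map_sum]
    refine (norm_sum_le _ _).trans ?_
    have h7 : ∀ α ∈ (Finset.univ : Finset (Fin r)), ‖fderiv ℝ P (Z (a₀ + t • v))
        (fderiv ℝ (fun a' => G.mul a' (G.inv (a₀ + t • v))) (a₀ + t • v) v α •
          G.extField α (Z (a₀ + t • v)))‖ ≤ B * ‖v‖ * C * ‖P (Z (a₀ + t • v))‖ := by
      intro α _
      rw [map_smul, norm_smul]
      have h8 := (norm_le_pi_norm _ α).trans (h3 v)
      have h9 := (norm_le_pi_norm
        (fun α => fderiv ℝ P (Z (a₀ + t • v)) (G.extField α (Z (a₀ + t • v)))) α).trans h1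
      calc _ ≤ (B * ‖v‖) * (C * ‖P (Z (a₀ + t • v))‖) :=
            mul_le_mul h8 h9 (norm_nonneg _) (by positivity)
        _ = _ := by ring
    refine (Finset.sum_le_sum h7).trans ?_
    simp [mul_assoc]
  -- Grönwall on the segment from a₀ to a: P ∘ Z starts at 0 and its derivative is bounded by a
  -- multiple of its norm.
  have hzero := eq_zero_of_abs_deriv_le_mul_abs_self_of_eq_zero_right
    (f := fun t : ℝ => P (Z (a₀ + t • v))) (a := 0) (b := 1)
    (fun t ht => (hder t ht).continuousAt.continuousWithinAt)
    (fun t ht => (hder t ⟨ht.1, ht.2.le⟩).hasDerivWithinAt) (by simp [hZ0, h0])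
    (fun t ht => hbound t ⟨ht.1, ht.2.le⟩) 1 ⟨zero_le_one, le_rfl⟩
  simpa [hv] using hzero

theorem eventually_ne_zero_of_ne_zero {Ω : Set (ExtJet m n N)} {P : ExtJet m n N → Fin q → ℝ}
    (hΩ : IsOpen Ω) (hP : ContDiffOn ℝ ∞ P Ω) {p p₀ : ExtJet m n N} {a₀ : Fin r → ℝ}
    (hp : G.ProlongsTo N a₀ p p₀) (hp₀ : p₀ ∈ Ω) (h0 : P p₀ ≠ 0) :
    ∀ᶠ a in 𝓝 a₀, ∀ p', G.ProlongsTo N a p p' → P p' ≠ 0 := by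
  have hp' := hp
  obtain ⟨hd, -, f, -, hf, hj, hi, -⟩ := hp
  obtain ⟨⟨x, w⟩, h⟩ := p
  dsimp only at hf hj hi
  have hd' : ((x, f x, h), a₀) ∈ G.dom := by rw [← jetAt_val (N := N) f x, hj]; exact hd
  obtain ⟨g, hg, hgf⟩ := G.exists_transform hf hd' hi
  have hZp := G.eventually_prolongsTo_transformPt (N := N) hf hd' hi hg hgf
  rw [hj] at hZp
  have hZ0 := hZp.self_of_nhds.unique hp'
  have hZs := (G.contDiffAt_transformPt (N := N) hd' hg.self_of_nhds).continuousAt.tendsto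
  rw [hZ0] at hZs
  have hPc : ContinuousAt P p₀ := (hP.contDiffAt (hΩ.mem_nhds hp₀)).continuousAt
  filter_upwards [hZp, hZs.eventually (hPc.eventually_ne h0)] with a h1 h2 p' h3
  rwa [← h1.unique h3]

/-- The infinitesimal criterion of invariance for systems of maximal rank. -/
theorem isInvariant_iff {Ω : Set (ExtJet m n N)} {P : Fin q → ExtJet m n N → ℝ}
    (hΩ : IsOpen Ω) (hΩM : ∀ p ∈ Ω, p.base ∈ G.M) (hP : ∀ lam, ContDiffOn ℝ ∞ (P lam) Ω)
    (hrank : ∀ p ∈ Ω, (∀ lam, P lam p = 0) →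
      Function.Surjective (fderiv ℝ (fun p' => fun lam => P lam p') p)) :
    G.IsInvariant Ω P ↔
      ∀ p ∈ Ω, (∀ lam, P lam p = 0) → ∀ α lam, G.prolongOpExt α N (P lam) p = 0 := by
  have hPd : ∀ lam, ∀ p ∈ Ω, DifferentiableAt ℝ (P lam) p := fun lam p hp =>
    ((hP lam).contDiffAt (hΩ.mem_nhds hp)).differentiableAt (by simp)
  constructor
  · intro hinv p hp h0 α lam
    obtain ⟨f, hf, hj⟩ := exists_jetAt_eq p.1
    have hM : (p.1.1, f p.1.1, p.2) ∈ G.M := by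
      rw [← jetAt_val (N := N) f, hj]; exact hΩM p hp
    obtain ⟨g, hg, hgf, hZp⟩ := G.exists_transform_zero (N := N) hf.contDiffAt hM
    rw [hj] at hZp
    set Z := G.transformPt N f p.1.1 p.2 g
    have hZ0 : Z 0 = p := hZp.self_of_nhds.eq_of_zero
    have hZd : DifferentiableAt ℝ Z 0 :=
      (G.contDiffAt_transformPt (G.zero_dom _ hM) (by rwa [G.phi_zero hM])).differentiableAt
        (by simp)
    have hZΩ : ∀ᶠ a in 𝓝 0, Z a ∈ Ω :=
      hZd.continuousAt.eventually (by rw [hZ0]; exact hΩ.mem_nhds hp)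
    obtain ⟨δ, hδ, hball⟩ := Metric.eventually_nhds_iff_ball.1 (hZp.and hZΩ)
    -- A ball is connected, so all small parameters lie in the component on which invariance speaks.
    have hsub : Metric.ball (0 : Fin r → ℝ) δ ⊆ connectedComponentIn (G.prolongDomain Ω p) 0 :=
      (convex_ball 0 δ).isPreconnected.subset_connectedComponentIn (Metric.mem_ball_self hδ)
        fun a ha => ⟨Z a, (hball a ha).2, (hball a ha).1⟩
    have hPZ : (fun a => P lam (Z a)) =ᶠ[𝓝 0] fun _ => 0 := by
      filter_upwards [Metric.ball_mem_nhds 0 hδ] with a ha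
      exact hinv p hp h0 a (hsub ha) (Z a) (hball a ha).1 lam
    have hc : HasFDerivAt (fun a => P lam (Z a)) _ 0 :=
      HasFDerivAt.comp (g := P lam) (0 : Fin r → ℝ)
        (by rw [hZ0]; exact (hPd lam p hp).hasFDerivAt) hZd.hasFDerivAt
    have h1 := congrArg (fun T => T (Pi.single α 1)) (hc.fderiv.symm.trans hPZ.fderiv_eq)
    rw [ContinuousLinearMap.comp_apply, G.fderiv_transformPt α hf.contDiffAt hM hg hgf,
      hj, ← jetAt_val (N := N) f, hj] at h1
    simpa [prolongOpExt] using h1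
  · intro hinf p hp h0 a ha p' hap' lam
    set Q : ExtJet m n N → Fin q → ℝ := fun p' lam => P lam p' with hQdef
    have hQ : ContDiffOn ℝ ∞ Q Ω := contDiffOn_pi.2 hP
    have hQ0 : ∀ p, Q p = 0 ↔ ∀ lam, P lam p = 0 := fun p => funext_iff
    have hinf' : ∀ p ∈ Ω, Q p = 0 → ∀ α, fderiv ℝ Q p (G.extField α p) = 0 := by
      intro p hp h0 α
      funext lam
      rw [fderiv_pi_apply (differentiableAt_pi.2 fun lam => hPd lam p hp)]
      exact hinf p hp ((hQ0 p).1 h0) α lam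
    -- Phrased with neighbourhoods, U and W are open by construction.
    set U : Set (Fin r → ℝ) := {a | ∀ᶠ a' in 𝓝 a, ∀ p', G.ProlongsTo N a' p p' → Q p' = 0}
    set W : Set (Fin r → ℝ) := {a | ∀ᶠ a' in 𝓝 a, ∀ p', G.ProlongsTo N a' p p' → Q p' ≠ 0}
    have hcD := connectedComponentIn_subset (G.prolongDomain Ω p) 0
    have hUW : connectedComponentIn (G.prolongDomain Ω p) 0 ⊆ U ∪ W := by
      intro a ha
      obtain ⟨p₁, hp₁, hap₁⟩ := hcD ha
      by_cases h1 : Q p₁ = 0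
      · exact Or.inl (G.eventually_zero_of_zero hΩ hΩM hQ
          (fun p hp h => hrank p hp ((hQ0 p).1 h)) hinf' hap₁ hp₁ h1)
      · exact Or.inr (G.eventually_ne_zero_of_ne_zero hΩ hQ hap₁ hp₁ h1)
    -- Disjointness is claimed only on the component: where no transform exists, both conditions can
    -- hold vacuously.
    have hdisj : connectedComponentIn (G.prolongDomain Ω p) 0 ∩ (U ∩ W) = ∅ := by
      rw [eq_empty_iff_forall_notMem]
      rintro a ⟨ha, haU, haW⟩
      obtain ⟨p₁, -, hap₁⟩ := hcD ha
      exact haW.self_of_nhds p₁ hap₁ (haU.self_of_nhds p₁ hap₁)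
    rcases isPreconnected_iff_subset_of_disjoint.1 isPreconnected_connectedComponentIn U W
      isOpen_setOfPred_eventually_nhds isOpen_setOfPred_eventually_nhds hUW hdisj with h1 | h1
    · exact congrFun ((h1 ha).self_of_nhds p' hap') lam
    -- `connectedComponentIn` is empty unless its base point lies in the set. So 0 is in the
    -- component, and it cannot be in W because its transform is the zero p itself.
    · have h00 : (0 : Fin r → ℝ) ∈ G.prolongDomain Ω p := by
        by_contra h2
        rw [connectedComponentIn_eq_empty h2] at ha
        exact ha
      obtain ⟨p₁, hp₁, hap₁⟩ := h00
      have h3 := (h1 (mem_connectedComponentIn ⟨p₁, hp₁, hap₁⟩)).self_of_nhds p₁ hap₁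
      rw [hap₁.eq_of_zero] at h3
      exact absurd ((hQ0 _).2 h0) h3

end StepGroup

/-! ### Differential approximations -/

/-- Forgetting the derivatives of order larger than `l`, as a linear map. -/
def truncL {m n N l : ℕ} (hl : l ≤ N) : Jet m n N →L[ℝ] Jet m n l :=
  (ContinuousLinearMap.fst ℝ _ _).prod (ContinuousLinearMap.pi fun K : MIdx m l =>
    (ContinuousLinearMap.proj (⟨K.1, K.2.trans hl⟩ : MIdx m N)).comp
      (ContinuousLinearMap.snd ℝ _ _))

theorem truncL_apply {m n N l : ℕ} (hl : l ≤ N) (z : Jet m n N) : truncL hl z = z.trunc l := by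
  refine Prod.ext rfl (funext fun K => ?_)
  simp only [Jet.trunc, Jet.coord]
  rw [dif_pos (K.2.trans hl)]
  rfl

/-- A surjective linear map between these finite-dimensional spaces is open. Openness turns
smoothness on the image into smoothness at its points. -/
theorem isOpen_trunc_image {m n N l : ℕ} (hl : l ≤ N) {Ω : Set (ExtJet m n N)} (hΩ : IsOpen Ω) :
    IsOpen ((fun p : ExtJet m n N => p.1.trunc l) '' Ω) := by
  have hs : Function.Surjective (truncL (m := m) (n := n) hl) := by
    intro z
    -- The preimage pads z with zeros, the default value of `coord` above order l.
    refine ⟨(z.1, fun K => z.coord K.1), Prod.ext rfl (funext fun K => ?_)⟩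
    change z.coord K.1 = z.2 K
    rw [Jet.coord, dif_pos K.2]
  have h := ((truncL hl).isOpenMap hs).comp (isOpenMap_fst (X := Jet m n N) (Y := Fin m → ℝ))
  have he : (truncL (m := m) (n := n) hl ∘ Prod.fst : ExtJet m n N → _) =
      fun p => p.1.trunc l := funext fun p => truncL_apply hl p.1
  rw [← he]
  exact h Ω hΩ

theorem contDiffAt_comp_trunc {m n N l : ℕ} (hl : l ≤ N) {Ω : Set (ExtJet m n N)}
    (hΩ : IsOpen Ω) {F : Jet m n l → ℝ}
    (hF : ContDiffOn ℝ ∞ F ((fun p : ExtJet m n N => p.1.trunc l) '' Ω)) {p : ExtJet m n N}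
    (hp : p ∈ Ω) : ContDiffAt ℝ ∞ (fun p : ExtJet m n N => F (p.1.trunc l)) p := by
  have h1 : ContDiffAt ℝ ∞ F (p.1.trunc l) :=
    hF.contDiffAt ((isOpen_trunc_image hl hΩ).mem_nhds ⟨p, hp, rfl⟩)
  simp only [← truncL_apply hl] at h1 ⊢
  exact ContDiffAt.comp (g := F) (f := fun p : ExtJet m n N => truncL hl p.1) p h1 (by fun_prop)

/-- The prolonged operator acts on a function of lower order as the operator of that order. -/
theorem StepGroup.prolongOpExt_comp_trunc {m n r N l : ℕ} (G : StepGroup m n r) (α : Fin r)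
    (hl : l ≤ N) {F : Jet m n l → ℝ} {p : ExtJet m n N} (hM : p.base ∈ G.M)
    (hF : DifferentiableAt ℝ F (p.1.trunc l)) :
    G.prolongOpExt α N (fun p : ExtJet m n N => F (p.1.trunc l)) p =
      G.prolongOp α l F (p.1.trunc l) := by
  rw [prolongOp, G.prolongField_trunc α hl hM, prolongOpExt]
  simp only [← truncL_apply hl] at hF ⊢
  have h1 : HasFDerivAt (fun p : ExtJet m n N => F (truncL hl p.1)) _ p :=
    HasFDerivAt.comp (g := F) (f := fun p : ExtJet m n N => truncL hl p.1) p hF.hasFDerivAt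
      ((truncL hl).hasFDerivAt.comp p hasFDerivAt_fst)
  rw [h1.fderiv]
  rfl

namespace DiffApprox

variable {m n q s l l' : ℕ} (A : DiffApprox m n q s l l') {Ω : Set (ExtJet m n l')}

theorem contDiffAt_corr (hΩ : IsOpen Ω)
    (hR : ∀ β lam i,
      ContDiffOn ℝ ∞ (A.R β lam i) ((fun p => p.1.trunc (A.ordR β lam i)) '' Ω))
    (lam : Fin q) {p : ExtJet m n l'} (hp : p ∈ Ω) : ContDiffAt ℝ ∞ (A.corr lam) p := by
  refine ContDiffAt.sum fun β _ => ContDiffAt.sum fun i _ => ContDiffAt.mul ?_ ?_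
  · fun_prop
  · exact contDiffAt_comp_trunc (A.ordR_le β lam i) hΩ (hR β lam i) hp

end DiffApprox

end StepLie

end

/-! ### The two criteria for differential approximations -/

theorem theorem1 {m n r q s l l' : ℕ} (G : StepLie.StepGroup m n r)
    (A : StepLie.DiffApprox m n q s l l')
    (Ω : Set (StepLie.ExtJet m n l')) (hΩ : IsOpen Ω) (hΩM : ∀ p ∈ Ω, p.base ∈ G.M)
    (hF : ∀ lam, ContDiffOn ℝ ∞ (A.F lam) ((fun p => p.1.trunc l) '' Ω))
    (hR : ∀ β lam i,
      ContDiffOn ℝ ∞ (A.R β lam i) ((fun p => p.1.trunc (A.ordR β lam i)) '' Ω))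
    (hrank : ∀ p ∈ Ω, (∀ lam, A.P lam p = 0) →
      Function.Surjective (fderiv ℝ (fun p' => fun lam => A.P lam p') p)) :
    (G.IsInvariant Ω A.P ↔
      ∀ p ∈ Ω, (∀ lam, A.P lam p = 0) → ∀ α lam, G.prolongOpExt α l' (A.P lam) p = 0) ∧
    (G.IsInvariant Ω A.P ↔
      ∀ p ∈ Ω, (∀ lam, A.P lam p = 0) → ∀ α lam,
        G.prolongOp α l (A.F lam) (p.1.trunc l) + G.prolongOpExt α l' (A.corr lam) p = 0) := by

  have hFd : ∀ lam, ∀ p ∈ Ω, ContDiffAt ℝ ∞ (fun p : StepLie.ExtJet m n l' =>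
      A.F lam (p.1.trunc l)) p := fun lam p hp =>
    StepLie.contDiffAt_comp_trunc A.l_le hΩ (hF lam) hp
  have hcorr : ∀ lam, ∀ p ∈ Ω, ContDiffAt ℝ ∞ (A.corr lam) p := fun lam p hp =>
    A.contDiffAt_corr hΩ hR lam hp
  have hinv := G.isInvariant_iff (P := A.P) hΩ hΩM
    (fun lam p hp => ((hFd lam p hp).add (hcorr lam p hp)).contDiffWithinAt) hrank
  refine ⟨hinv, hinv.trans (forall₂_congr fun p hp => forall_congr' fun _ =>
    forall₂_congr fun α lam => ?_)⟩
  have h1 : DifferentiableAt ℝ (A.F lam) (p.1.trunc l) :=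
    ((hF lam).contDiffAt ((StepLie.isOpen_trunc_image A.l_le hΩ).mem_nhds
      ⟨p, hp, rfl⟩)).differentiableAt (by simp)
  have h2 : G.prolongOpExt α l' (A.P lam) p =
      G.prolongOpExt α l' (fun p => A.F lam (p.1.trunc l)) p +
        G.prolongOpExt α l' (A.corr lam) p := by
    have h3 : HasFDerivAt (A.P lam) _ p :=
      ((hFd lam p hp).differentiableAt (by simp)).hasFDerivAt.add
        ((hcorr lam p hp).differentiableAt (by simp)).hasFDerivAt
    rw [StepLie.StepGroup.prolongOpExt, h3.fderiv]
    rfl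
  -- On 𝓕 the operator of order l' reduces to that of order l, so both criteria impose the same
  -- equation at each zero.
  rw [h2, G.prolongOpExt_comp_trunc α A.l_le (hΩM p hp) h1]
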